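/- **Setting.** Let $K$ be the number of arms, $\Theta$ an arbitrary set, $\mu_1,\dots,\mu_K:\Theta\to\mathbb R$ arbitrary known functions, $\theta^*\in\Theta$ the unknown true parameter, and $k^*\in\arg\max_k\mu_k(\theta^*)$ the optimal arm. In each round $t=1,2,\dots$ an arm $k_t$ is pulled and a reward is observed; given the past and $k_t=k$, the reward has a fixed (unknown) law with mean $\mu_k(\theta^*)$ that is sub-Gaussian with variance proxy $\sigma^2$, where $\sigma>0$ is known. Let $n_k(t)$ be the number of pulls of arm $k$ in the first $t$ rounds and $\hat\mu_k(t)$ the average of the rewards obtained from them. The regret is $\mathrm{Reg}(T)=\sum_{t=1}^T(\mu_{k^*}(\theta^*)-\mu_{k_t}(\theta^*))$. **Algorithms.** Let $\alpha>3$ and $\beta>1$. In round $t+1$ both algorithms form $$\hat\Theta_t=\Big\{\theta\in\Theta:\ |\mu_k(\theta)-\hat\mu_k(t)|<\sqrt{2\alpha\sigma^2\log t/n_k(t)}\ \text{ for all }k\Big\},$$ where the right-hand side is $+\infty$ if $n_k(t)=0$, and let $\mathcal C_t$ be the set of arms $k$ such that $\mu_k(\theta)=\max_\ell\mu_\ell(\theta)$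 for some $\theta\in\hat\Theta_t$ (all arms, if $\hat\Theta_t=\emptyset$). UCB-C pulls an arm of $\mathcal C_t$ maximizing $\hat\mu_k(t)+\sqrt{2\alpha\sigma^2\log t/n_k(t)}$ (which is $+\infty$ if $n_k(t)=0$). TS-C draws independent samples $S_{k,t}\sim\mathcal N(\hat\mu_k(t),\beta\sigma^2/n_k(t))$ and pulls an arm of $\mathcal C_t$ maximizing $S_{k,t}$ over $\mathcal C_t$; arms of $\mathcal C_t$ with $n_k(t)=0$ are pulled first. Ties are broken in any way that depends only on the past (possibly at random). **Competitive arms.** For $\varepsilon>0$ let $\Theta^{*(\varepsilon)}=\{\theta\in\Theta:|\mu_{k^*}(\theta^*)-\mu_{k^*}(\theta)|<\varepsilon\}$. An arm $k$ is competitive if for every $\varepsilon>0$ there is $\theta\in\Theta^{*(\varepsilon)}$ with $\mu_k(\theta)=\max_\ell\mu_\ell(\theta)$, and non-competitive otherwise. Let $C(\theta^*)$ be the number of competitive arms. **Theorem 1 (Expected regret scaling).** For each of UCB-C and TS-C there are constants $c_1,c_2\ge 0$, depending only on $(\mu_k)_k,\theta^*,k^*,\sigma,\alpha$ (and $\beta$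 for TS-C), but not on $T$, the reward laws or the tie-breaking, such that for all $T\ge 2$ $$\mathbb E[\mathrm{Reg}(T)]\le (C(\theta^*)-1)\,c_1\log T+(K-C(\theta^*))\,c_2 .$$ In particular, if $C(\theta^*)=1$, the expected regret is bounded: $\mathbb E[\mathrm{Reg}(T)]\le (K-1)c_2$ for all $T$. -/

import Mathlib

open MeasureTheory ProbabilityTheory
open scoped NNReal ENNReal

noncomputable section

namespace StructuredBandit

/-! ### Competitive arms -/

/-- `Θ^{*(ε)} = {θ : |μ_{k*}(θ*) - μ_{k*}(θ)| < ε}`, the `ε`-neighbourhood of the level set of the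
mean reward function of the arm `kstar` through `θstar`. -/
def levelNbhd {K : ℕ} {Θ : Type*} (μ : Fin K → Θ → ℝ) (kstar : Fin K) (θstar : Θ) (ε : ℝ) :
    Set Θ :=
  {θ | |μ kstar θstar - μ kstar θ| < ε}

/-- Arm `k` is competitive with respect to a set `S` of parameters: its mean reward is the highest
among all arms for some `θ ∈ S`. -/
def CompetitiveOn {K : ℕ} {Θ : Type*} (μ : Fin K → Θ → ℝ) (S : Set Θ) (k : Fin K) : Prop :=
  ∃ θ ∈ S, ∀ l, μ l θ ≤ μ k θ

/-- Arm `k` is competitive: for every `ε > 0` it is optimal for some `θ` in the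
`ε`-neighbourhood of the level set of the optimal arm. -/
def Competitive {K : ℕ} {Θ : Type*} (μ : Fin K → Θ → ℝ) (kstar : Fin K) (θstar : Θ)
    (k : Fin K) : Prop :=
  ∀ ε : ℝ, 0 < ε → CompetitiveOn μ (levelNbhd μ kstar θstar ε) k

/-- `C(θ*)`, the number of competitive arms. -/
def numCompetitive {K : ℕ} {Θ : Type*} (μ : Fin K → Θ → ℝ) (kstar : Fin K) (θstar : Θ) : ℕ :=
  {k : Fin K | Competitive μ kstar θstar k}.ncard

/-! ### Histories and the empirical quantities computed from them -/

/-- The pulled arms and observed rewards of the first `t` rounds (round `i + 1` has index `i`). -/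
abbrev History (K t : ℕ) : Type := Fin t → Fin K × ℝ

/-- `n_k(t)`, the number of pulls of arm `k` in the first `t` rounds. -/
def pulls {K t : ℕ} (h : History K t) (k : Fin K) : ℕ :=
  (Finset.univ.filter fun i => (h i).1 = k).card

/-- `μ̂_k(t)`, the average of the rewards obtained from arm `k` in the first `t` rounds
(used only when arm `k` has been pulled). -/
def empMean {K t : ℕ} (h : History K t) (k : Fin K) : ℝ :=
  (∑ i ∈ Finset.univ.filter (fun i => (h i).1 = k), (h i).2) / (pulls h k : ℝ)

/-- `√(2 α σ² log t / n_k(t))`, to be read as `+∞` when `n_k(t) = 0`; this case is treated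
separately wherever the width is used. -/
def width {K t : ℕ} (α : ℝ) (σ : ℝ≥0) (h : History K t) (k : Fin K) : ℝ :=
  Real.sqrt (2 * α * (σ : ℝ) ^ 2 * Real.log (t : ℝ) / (pulls h k : ℝ))

/-- The confidence set of parameters. An arm that has not been pulled has infinite width and
imposes no constraint. -/
def confSet {K t : ℕ} {Θ : Type*} (μ : Fin K → Θ → ℝ) (α : ℝ) (σ : ℝ≥0) (h : History K t) :
    Set Θ :=
  {θ | ∀ k, pulls h k ≠ 0 → |μ k θ - empMean h k| < width α σ h k}

/-- The set `C_t` of arms among which the algorithms choose: all arms when the confidence set is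
empty, and otherwise the arms that are optimal for some parameter of the confidence set. -/
def candidates {K t : ℕ} {Θ : Type*} (μ : Fin K → Θ → ℝ) (α : ℝ) (σ : ℝ≥0) (h : History K t) :
    Set (Fin K) :=
  {k | confSet μ α σ h = ∅ ∨ CompetitiveOn μ (confSet μ α σ h) k}

/-- The UCB index `μ̂_k(t) + √(2 α σ² log t / n_k(t))`, infinite for an arm not yet pulled. -/
def ucbIndex {K t : ℕ} (α : ℝ) (σ : ℝ≥0) (h : History K t) (k : Fin K) : EReal :=
  if pulls h k = 0 then ⊤ else ((empMean h k + width α σ h k : ℝ) : EReal)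

/-! ### Policies and the two algorithms -/

/-- A policy: for every `t`, the conditional law of the arm pulled in round `t + 1` given the
history of the first `t` rounds. -/
abbrev Policy (K : ℕ) : Type := (t : ℕ) → Kernel (History K t) (Fin K)

/-- `π` is a UCB-C policy: every arm that it can pull maximizes the UCB index over `C_t`
(ties may be broken in any way, also at random). -/
def IsUCBC {K : ℕ} {Θ : Type*} (μ : Fin K → Θ → ℝ) (α : ℝ) (σ : ℝ≥0) (π : Policy K) : Prop :=
  ∀ (t : ℕ) (h : History K t) (k : Fin K), π t h {k} ≠ 0 →
    k ∈ candidates μ α σ h ∧ ∀ j ∈ candidates μ α σ h, ucbIndex α σ h j ≤ ucbIndex α σ h k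

/-- The joint law of independent Thompson samples `S_k ∼ N(μ̂_k(t), β σ² / n_k(t))`
(only the samples of arms that have been pulled are used). -/
def tsLaw {K t : ℕ} (β σ : ℝ≥0) (h : History K t) : Measure (Fin K → ℝ) :=
  Measure.pi fun k => gaussianReal (empMean h k) (β * σ ^ 2 / (pulls h k : ℝ≥0))

/-- `π` is a TS-C policy: it pulls the arm of `C_t` with the largest Thompson sample, that is, it
pulls `k ∈ C_t` with the probability that the sample of `k` is the largest one over `C_t`. The
posterior of an arm that has not been pulled has infinite variance; as for the UCB index, arms of
`C_t` that have not been pulled have priority (ties among them are broken in any way). -/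
def IsTSC {K : ℕ} {Θ : Type*} (μ : Fin K → Θ → ℝ) (α : ℝ) (β σ : ℝ≥0) (π : Policy K) : Prop :=
  ∀ (t : ℕ) (h : History K t),
    ((∃ k ∈ candidates μ α σ h, pulls h k = 0) →
      ∀ k, π t h {k} ≠ 0 → k ∈ candidates μ α σ h ∧ pulls h k = 0) ∧
    ((∀ k ∈ candidates μ α σ h, pulls h k ≠ 0) →
      (∀ k ∈ candidates μ α σ h,
        π t h {k} = tsLaw β σ h {S | ∀ j ∈ candidates μ α σ h, S j ≤ S k}) ∧
      ∀ k ∉ candidates μ α σ h, π t h {k} = 0)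

/-! ### Interaction of a policy with the environment, and regret -/

/-- The history of the first `t` rounds of the process of pulled arms `A` and rewards `R`;
`A t` is the arm pulled in round `t + 1` and `R t` the reward observed in that round. -/
def history {Ω : Type*} {K : ℕ} (A : ℕ → Ω → Fin K) (R : ℕ → Ω → ℝ) (t : ℕ) (ω : Ω) :
    History K t :=
  fun i => (A i ω, R i ω)

/-- The process `(A, R)` results from running the policy `π` when the rewards of arm `k` have law
`ν k`: given the past, the next arm has law `π t (history)`, and given the past and the arm `k`
just pulled, the reward has law `ν k`. -/
structure IsRun {Ω : Type*} [MeasurableSpace Ω] {K : ℕ} (π : Policy K) (ν : Kernel (Fin K) ℝ)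
    (P : Measure Ω) (A : ℕ → Ω → Fin K) (R : ℕ → Ω → ℝ) : Prop where
  measurable_arm : ∀ t, Measurable (A t)
  measurable_reward : ∀ t, Measurable (R t)
  arm_law : ∀ t, HasCondDistrib (A t) (history A R t) (π t) P
  reward_law : ∀ t, HasCondDistrib (R t) (fun ω => (history A R t ω, A t ω))
    (Kernel.prodMkLeft (History K t) ν) P

/-- The reward laws `ν` are compatible with the true parameter: arm `k` has mean reward `μ_k(θ*)`
and is sub-Gaussian with variance proxy `σ²`. -/
def IsRewardLaw {K : ℕ} {Θ : Type*} (μ : Fin K → Θ → ℝ) (θstar : Θ) (σ : ℝ≥0)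
    (ν : Kernel (Fin K) ℝ) : Prop :=
  ∀ k, ∫ x, x ∂(ν k) = μ k θstar ∧ HasSubgaussianMGF (fun x => x - μ k θstar) (σ ^ 2) (ν k)

/-- `E[Reg(T)]`, with `Reg(T) = ∑_{t = 1}^{T} (μ_{k*}(θ*) - μ_{k_t}(θ*))`. -/
def expRegret {Ω : Type*} [MeasurableSpace Ω] {K : ℕ} {Θ : Type*} (μ : Fin K → Θ → ℝ)
    (kstar : Fin K) (θstar : Θ) (P : Measure Ω) (A : ℕ → Ω → Fin K) (T : ℕ) : ℝ :=
  ∫ ω, ∑ t ∈ Finset.range T, (μ kstar θstar - μ (A t ω) θstar) ∂P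

end StructuredBandit

end

/-! The regret is the sum over arms of the gap times the expected number of pulls, so it suffices to
show that certain events at time `t` have probabilities summable in `t`, uniformly over runs
(`SummablyRare`).

Everything rests on one claim: for every `M`, the optimal arm is rarely "starved", that is, pulled
fewer than `M log t` times. If it is not starved and `θstar` lies in the confidence set, then its
width is below `ε / 2`, every parameter of the confidence set lies in the `ε`-neighbourhood of the
level set, and an arm that is not optimal anywhere there is not a candidate. Hence non-competitive
arms are pulled boundedly often in expectation (`summablyRare_of_not_competitive`). A suboptimal
competitive arm with `L log t` pulls behind it is rarely pulled again, by the usual index comparison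
for UCB-C and by Gaussian tails for TS-C, so it costs `O(log T)` (`exists_expRegret_le`).

Starvation is excluded as follows. Some arm `l` has at least `2 * N` pulls with `N = t / (2 * K)`,
hence `N` pulls in rounds where its mean is already known up to order `√(log t / t)`. These rounds
are late, so `α > 3` puts `θstar` in their confidence sets and the optimal arm among their
candidates. Under UCB-C its index exceeds its true mean by a multiple of `√(log t / n)` with `n < M
log t`, so `l` cannot win: a contradiction (`summablyRare_starved_ucb`).

Under TS-C the sample of the optimal arm exceeds what `l` can typically reach with conditional
probability at least `2 t ^ (-ρ')` for some `ρ' < 1`. This uses `β > 1`: only logarithmically many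
pull counts enter the union bound, so deviations at a level `a` strictly between `1` and `β` are
already rare. The chance of pulling `l` is then controlled by that of pulling the optimal arm
(`IsTSC.dominated`), and an exponential potential rewarding pulls of `l` and penalising pulls of the
optimal arm (`IsRun.lintegral_potential_le`) shows that many of the former with few of the latter
are rare.

Concentration under adaptive sampling comes from an exponential supermartingale for the first `s`
rewards of an arm (`IsRun.lintegral_exp_truncSum_sub_le`). Union bounds then run over pull counts
instead of rounds. -/

namespace StructuredBandit

/-! ### Counts and truncated sums along a run -/

/-- The number of pulls of arm `k` in the first `t` rounds. -/
def armCount {Ω : Type*} {K : ℕ} (A : ℕ → Ω → Fin K) (k : Fin K) (t : ℕ) (ω : Ω) : ℕ :=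
  ∑ i ∈ Finset.range t, if A i ω = k then 1 else 0

/-- The sum of the deviations from `m` of the first `s` rewards of arm `k`, as far as they are
observed in the first `t` rounds. -/
noncomputable def truncSum {Ω : Type*} {K : ℕ} (A : ℕ → Ω → Fin K) (R : ℕ → Ω → ℝ) (m : ℝ)
    (k : Fin K) (s t : ℕ) (ω : Ω) : ℝ :=
  ∑ i ∈ Finset.range t, if A i ω = k ∧ armCount A k i ω < s then R i ω - m else 0

section Pathwise

variable {Ω : Type*} {K : ℕ} {A : ℕ → Ω → Fin K} {R : ℕ → Ω → ℝ} {k : Fin K} {ω : Ω}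

@[simp] lemma armCount_zero : armCount A k 0 ω = 0 := by simp [armCount]

lemma armCount_succ (t : ℕ) :
    armCount A k (t + 1) ω = armCount A k t ω + if A t ω = k then 1 else 0 := by
  rw [armCount, Finset.sum_range_succ, ← armCount]

lemma armCount_mono : Monotone fun t => armCount A k t ω :=
  monotone_nat_of_le_succ fun t => by simp [armCount_succ]

lemma armCount_le (t : ℕ) : armCount A k t ω ≤ t := by
  induction t with
  | zero => simp
  | succ t ih => rw [armCount_succ]; split_ifs <;> omega

lemma sum_armCount (t : ℕ) : ∑ k, armCount A k t ω = t := by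
  simp only [armCount]
  rw [Finset.sum_comm]
  simp

lemma pulls_history (t : ℕ) : pulls (history A R t ω) k = armCount A k t ω := by
  rw [pulls, Finset.card_filter]
  exact Fin.sum_univ_eq_sum_range (fun i => if A i ω = k then 1 else 0) t

lemma empMean_history (t : ℕ) : empMean (history A R t ω) k =
    (∑ i ∈ Finset.range t, if A i ω = k then R i ω else 0) / (armCount A k t ω : ℝ) := by
  rw [empMean, pulls_history]
  congr 1
  rw [Finset.sum_filter]
  exact Fin.sum_univ_eq_sum_range (fun i => if A i ω = k then R i ω else 0) t

/-- The number of pulls of an arm after its first `s` pulls. -/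
lemma sum_pulls_ge (s t : ℕ) :
    (∑ i ∈ Finset.range t, if A i ω = k ∧ s ≤ armCount A k i ω then 1 else 0) =
      armCount A k t ω - s := by
  induction t with
  | zero => simp
  | succ t ih =>
    rw [Finset.sum_range_succ, ih, armCount_succ]
    by_cases h : A t ω = k <;> by_cases h' : s ≤ armCount A k t ω <;> simp [h, h'] <;> omega

/-- The number of pulls of an arm before it has been pulled `x` times. -/
lemma sum_pulls_lt_le {x : ℝ} (hx : 0 ≤ x) (t : ℕ) :
    (∑ i ∈ Finset.range t, if A i ω = k ∧ (armCount A k i ω : ℝ) < x then (1 : ℝ) else 0) ≤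
      x + 1 := by
  -- The bound `x + 1` alone is not inductive; the minimum with the current count is.
  have key : (∑ i ∈ Finset.range t,
      if A i ω = k ∧ (armCount A k i ω : ℝ) < x then (1 : ℝ) else 0) ≤
        min (armCount A k t ω : ℝ) (x + 1) := by
    induction t with
    | zero => simpa using by linarith
    | succ t ih =>
      rw [Finset.sum_range_succ, armCount_succ]
      rw [le_min_iff] at ih
      by_cases h : A t ω = k
      · by_cases h' : (armCount A k t ω : ℝ) < x
        · simp only [h, h', and_self, if_true, Nat.cast_add, Nat.cast_one]
          exact le_min (by linarith) (by linarith)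
        · simp only [h, h', and_false, if_false, if_true, Nat.cast_add, Nat.cast_one]
          exact le_min (by linarith) (by linarith)
      · simpa [h] using ih
  exact key.trans (min_le_right _ _)

lemma truncSum_eq_sum (m : ℝ) {s t : ℕ} (h : armCount A k t ω ≤ s) :
    truncSum A R m k s t ω =
      (∑ i ∈ Finset.range t, if A i ω = k then R i ω else 0) - armCount A k t ω * m := by
  induction t with
  | zero => simp [truncSum]
  | succ t ih =>
    have hle := armCount_mono (A := A) (k := k) (ω := ω) (Nat.le_succ t)
    have ih := ih (hle.trans h)
    rw [truncSum] at ih ⊢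
    rw [Finset.sum_range_succ, ih, Finset.sum_range_succ]
    rw [armCount_succ] at h ⊢
    by_cases hk : A t ω = k
    · rw [if_pos hk] at h
      rw [if_pos ⟨hk, by omega⟩, if_pos hk, if_pos hk]
      push_cast
      ring
    · simp [hk]

/-- The sum is frozen once the arm has `s` pulls. Means at random rounds thus become variables
indexed by a deterministic `s` at a fixed horizon. -/
lemma truncSum_eq_of_le (m : ℝ) {s i t : ℕ} (hit : i ≤ t) (h : s ≤ armCount A k i ω) :
    truncSum A R m k s t ω = truncSum A R m k s i ω := by
  induction t, hit using Nat.le_induction with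
  | base => rfl
  | succ t ht ih =>
    rw [truncSum, Finset.sum_range_succ, ← truncSum, ih, if_neg, add_zero]
    rintro ⟨-, h'⟩
    have := armCount_mono (A := A) (k := k) (ω := ω) ht
    simp only at this
    omega

/-- The deviation of an empirical mean, as a truncated sum at a later time. -/
lemma truncSum_eq_empMean (m : ℝ) {i t : ℕ} (hit : i ≤ t) (h : armCount A k i ω ≠ 0) :
    truncSum A R m k (armCount A k i ω) t ω =
      armCount A k i ω * (empMean (history A R i ω) k - m) := by
  have h' : (armCount A k i ω : ℝ) ≠ 0 := by exact_mod_cast h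
  rw [truncSum_eq_of_le m hit le_rfl, truncSum_eq_sum m le_rfl, empMean_history]
  field_simp

end Pathwise

/-! ### Measurability with respect to the past -/

/-- The σ-algebra generated by the first `t` rounds. -/
abbrev past {Ω : Type*} {K : ℕ} (A : ℕ → Ω → Fin K) (R : ℕ → Ω → ℝ) (t : ℕ) :
    MeasurableSpace Ω :=
  MeasurableSpace.comap (history A R t) inferInstance

section Measurability

variable {Ω : Type*} {K : ℕ} {A : ℕ → Ω → Fin K} {R : ℕ → Ω → ℝ}

lemma measurable_arm_past {i t : ℕ} (h : i < t) : Measurable[past A R t] (A i) := by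
  have h1 : Measurable fun x : History K t => (x ⟨i, h⟩).1 := by fun_prop
  exact h1.comp (comap_measurable (history A R t))

lemma measurable_reward_past {i t : ℕ} (h : i < t) : Measurable[past A R t] (R i) := by
  have h1 : Measurable fun x : History K t => (x ⟨i, h⟩).2 := by fun_prop
  exact h1.comp (comap_measurable (history A R t))

lemma measurableSet_arm_past {i t : ℕ} (h : i < t) (k : Fin K) :
    MeasurableSet[past A R t] {ω | A i ω = k} :=
  measurable_arm_past h (measurableSet_singleton k)

lemma measurable_armCount_past {i t : ℕ} (h : i ≤ t) (k : Fin K) :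
    Measurable[past A R t] (armCount A k i) := by
  unfold armCount
  refine Finset.measurable_fun_sum _ fun j hj => ?_
  exact Measurable.ite (measurableSet_arm_past ((Finset.mem_range.1 hj).trans_le h) k)
    measurable_const measurable_const

lemma measurable_truncSum_past {i t : ℕ} (h : i ≤ t) (m : ℝ) (k : Fin K) (s : ℕ) :
    Measurable[past A R t] (truncSum A R m k s i) := by
  unfold truncSum
  refine Finset.measurable_fun_sum _ fun j hj => ?_
  have hj := (Finset.mem_range.1 hj).trans_le h
  refine Measurable.ite ((measurableSet_arm_past hj k).inter
    (measurable_armCount_past hj.le k (measurableSet_Iio (a := s)))) ?_ measurable_const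
  exact (measurable_reward_past hj).sub measurable_const

end Measurability

/-! ### Conditional laws of the next arm and the next reward. -/

section Run

variable {Ω : Type*} [MeasurableSpace Ω] {K : ℕ} {π : Policy K} {ν : Kernel (Fin K) ℝ}
  {P : Measure Ω} {A : ℕ → Ω → Fin K} {R : ℕ → Ω → ℝ}

lemma IsRun.measurable_history (hrun : IsRun π ν P A R) (t : ℕ) : Measurable (history A R t) :=
  measurable_pi_iff.2 fun i => (hrun.measurable_arm i).prodMk (hrun.measurable_reward i)

lemma IsRun.past_le (hrun : IsRun π ν P A R) (t : ℕ) : past A R t ≤ ‹MeasurableSpace Ω› :=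
  (hrun.measurable_history t).comap_le

/-- A function measurable in the past factors through the history, so this is disintegration of the
joint law of history and arm. Using `ℝ≥0∞` avoids integrability conditions. -/
lemma IsRun.lintegral_arm [IsProbabilityMeasure P] [∀ t, IsMarkovKernel (π t)]
    (hrun : IsRun π ν P A R) (t : ℕ) (k : Fin K) {g : Ω → ℝ≥0∞} (hg : Measurable[past A R t] g) :
    ∫⁻ ω, g ω * (if A t ω = k then 1 else 0) ∂P = ∫⁻ ω, g ω * π t (history A R t ω) {k} ∂P := by
  obtain ⟨g, hg', rfl⟩ := hg.exists_eq_measurable_comp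
  have hH := hrun.measurable_history t
  have hf : Measurable fun x : History K t × Fin K => g x.1 * (if x.2 = k then 1 else 0) :=
    (hg'.comp measurable_fst).mul
      (Measurable.ite (measurable_snd (measurableSet_singleton k)) measurable_const
        measurable_const)
  calc ∫⁻ ω, (g ∘ history A R t) ω * (if A t ω = k then 1 else 0) ∂P
      = ∫⁻ x, g x.1 * (if x.2 = k then 1 else 0)
          ∂(P.map fun ω => (history A R t ω, A t ω)) := by
        rw [lintegral_map hf (hH.prodMk (hrun.measurable_arm t))]
        rfl
    _ = ∫⁻ h, ∫⁻ a, g h * (if a = k then 1 else 0) ∂(π t h) ∂(P.map (history A R t)) := by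
        have := Measure.isProbabilityMeasure_map (μ := P) hH.aemeasurable
        rw [(hrun.arm_law t).map_eq, Measure.lintegral_compProd hf]
    _ = ∫⁻ h, g h * π t h {k} ∂(P.map (history A R t)) := by
        refine lintegral_congr fun h => ?_
        rw [lintegral_const_mul _ (measurable_of_finite _)]
        congr 1
        rw [← lintegral_indicator_one (measurableSet_singleton k)]
        refine lintegral_congr fun a => ?_
        simp [Set.indicator_apply]
    _ = _ := by
        exact lintegral_map (hg'.mul ((π t).measurable_coe (measurableSet_singleton k))) hH

lemma IsRun.lintegral_reward [IsProbabilityMeasure P] [IsMarkovKernel ν]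
    (hrun : IsRun π ν P A R) (t : ℕ) (k : Fin K) {g : Ω → ℝ≥0∞} (hg : Measurable[past A R t] g)
    {f : ℝ → ℝ≥0∞} (hf : Measurable f) :
    ∫⁻ ω, g ω * (if A t ω = k then f (R t ω) else 0) ∂P =
      ∫⁻ ω, g ω * (if A t ω = k then ∫⁻ x, f x ∂(ν k) else 0) ∂P := by
  obtain ⟨g, hg', rfl⟩ := hg.exists_eq_measurable_comp
  have hH := (hrun.measurable_history t).prodMk (hrun.measurable_arm t)
  have hF : Measurable fun x : (History K t × Fin K) × ℝ =>
      g x.1.1 * (if x.1.2 = k then f x.2 else 0) :=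
    (hg'.comp (measurable_fst.comp measurable_fst)).mul
      (Measurable.ite ((measurable_snd.comp measurable_fst) (measurableSet_singleton k))
        (hf.comp measurable_snd) measurable_const)
  have hG : Measurable fun x : History K t × Fin K =>
      g x.1 * (if x.2 = k then ∫⁻ x, f x ∂(ν k) else 0) :=
    (hg'.comp measurable_fst).mul
      (Measurable.ite (measurable_snd (measurableSet_singleton k)) measurable_const
        measurable_const)
  calc ∫⁻ ω, (g ∘ history A R t) ω * (if A t ω = k then f (R t ω) else 0) ∂P
      = ∫⁻ x, g x.1.1 * (if x.1.2 = k then f x.2 else 0)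
          ∂(P.map fun ω => ((history A R t ω, A t ω), R t ω)) := by
        rw [lintegral_map hF (hH.prodMk (hrun.measurable_reward t))]
        rfl
    _ = ∫⁻ x, ∫⁻ r, g x.1 * (if x.2 = k then f r else 0) ∂(ν x.2)
          ∂(P.map fun ω => (history A R t ω, A t ω)) := by
        have := Measure.isProbabilityMeasure_map (μ := P) hH.aemeasurable
        rw [(hrun.reward_law t).map_eq, Measure.lintegral_compProd hF]
        rfl
    _ = ∫⁻ x, g x.1 * (if x.2 = k then ∫⁻ x, f x ∂(ν k) else 0)
          ∂(P.map fun ω => (history A R t ω, A t ω)) := by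
        refine lintegral_congr fun x => ?_
        by_cases h : x.2 = k
        · simp only [h, if_true]
          rw [lintegral_const_mul _ hf]
        · simp [h]
    _ = _ := by
        rw [lintegral_map hG hH]
        rfl

end Run

/-! ### Concentration of the empirical means -/

section Concentration

variable {Ω : Type*} [MeasurableSpace Ω] {K : ℕ} {π : Policy K} {ν : Kernel (Fin K) ℝ}
  {P : Measure Ω} {A : ℕ → Ω → Fin K} {R : ℕ → Ω → ℝ}

lemma IsRun.measurable_truncSum (hrun : IsRun π ν P A R) (m : ℝ) (k : Fin K) (s t : ℕ) :
    Measurable (truncSum A R m k s t) :=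
  (measurable_truncSum_past le_rfl m k s).mono (hrun.past_le t) le_rfl

lemma IsRun.measurable_armCount (hrun : IsRun π ν P A R) (k : Fin K) (t : ℕ) :
    Measurable (armCount A k t) :=
  (measurable_armCount_past le_rfl k).mono (hrun.past_le t) le_rfl

lemma lintegral_exp_sub_le {ρ : Measure ℝ} {X : ℝ → ℝ} {c : ℝ≥0} (h : HasSubgaussianMGF X c ρ)
    (l : ℝ) : ∫⁻ x, ENNReal.ofReal (Real.exp (l * X x - c * l ^ 2 / 2)) ∂ρ ≤ 1 := by
  have h1 : ∀ x, ENNReal.ofReal (Real.exp (l * X x - c * l ^ 2 / 2)) =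
      ENNReal.ofReal (Real.exp (-(c * l ^ 2 / 2))) * ENNReal.ofReal (Real.exp (l * X x)) := by
    intro x
    rw [← ENNReal.ofReal_mul (Real.exp_nonneg _), ← Real.exp_add]
    congr 2
    ring
  simp_rw [h1]
  rw [lintegral_const_mul' _ _ ENNReal.ofReal_ne_top,
    ← ofReal_integral_eq_lintegral_ofReal (h.integrable_exp_mul l)
      (ae_of_all _ fun _ => Real.exp_nonneg _),
    ← ENNReal.ofReal_mul (Real.exp_nonneg _)]
  refine ENNReal.ofReal_le_one.2 ?_
  calc _ ≤ Real.exp (-(c * l ^ 2 / 2)) * Real.exp (c * l ^ 2 / 2) :=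
        mul_le_mul_of_nonneg_left (h.mgf_le l) (Real.exp_nonneg _)
    _ = 1 := by rw [← Real.exp_add]; simp

/-- The exponential supermartingale of the truncated sums. -/
lemma IsRun.lintegral_exp_truncSum_sub_le [IsProbabilityMeasure P] [IsMarkovKernel ν]
    (hrun : IsRun π ν P A R) {k : Fin K} {m : ℝ} {v : ℝ≥0}
    (hk : HasSubgaussianMGF (fun x => x - m) v (ν k)) (l : ℝ) (s t : ℕ) :
    ∫⁻ ω, ENNReal.ofReal (Real.exp (l * truncSum A R m k s t ω -
      v * l ^ 2 / 2 * (min (armCount A k t ω) s : ℕ))) ∂P ≤ 1 := by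
  induction t with
  | zero => simp [truncSum]
  | succ t ih =>
    set g : Ω → ℝ≥0∞ := fun ω => ENNReal.ofReal (Real.exp (l * truncSum A R m k s t ω -
      v * l ^ 2 / 2 * (min (armCount A k t ω) s : ℕ))) with hg
    set f : ℝ → ℝ≥0∞ := fun x => ENNReal.ofReal (Real.exp (l * (x - m) - v * l ^ 2 / 2)) with hf
    -- A round multiplies the process by `f (R t ω)` when `k` is pulled with fewer than `s` earlier
    -- pulls, and by `1` otherwise. The integral of `f` under `ν k` is at most `1`.
    set g₁ : Ω → ℝ≥0∞ := fun ω => g ω * if armCount A k t ω < s then 1 else 0 with hg₁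
    have hn : MeasurableSet[past A R t] {ω | armCount A k t ω < s} :=
      measurable_armCount_past le_rfl k (measurableSet_Iio (a := s))
    have hgm : Measurable[past A R t] g := by
      refine ENNReal.measurable_ofReal.comp (Real.measurable_exp.comp ?_)
      refine Measurable.sub ((measurable_truncSum_past le_rfl m k s).const_mul l) ?_
      exact (measurable_from_top (f := fun n : ℕ => v * l ^ 2 / 2 * ((min n s : ℕ) : ℝ))).comp
        (measurable_armCount_past le_rfl k)
    have hg₁m : Measurable[past A R t] g₁ :=
      hgm.mul (Measurable.ite hn measurable_const measurable_const)
    have hfm : Measurable f := by fun_prop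
    have step : ∀ ω, ENNReal.ofReal (Real.exp (l * truncSum A R m k s (t + 1) ω -
        v * l ^ 2 / 2 * (min (armCount A k (t + 1) ω) s : ℕ))) =
        g ω * (if A t ω = k ∧ armCount A k t ω < s then 0 else 1) +
          g₁ ω * (if A t ω = k then f (R t ω) else 0) := by
      intro ω
      have hZ : truncSum A R m k s (t + 1) ω = truncSum A R m k s t ω +
          if A t ω = k ∧ armCount A k t ω < s then R t ω - m else 0 := by
        rw [truncSum, Finset.sum_range_succ, ← truncSum]
      rw [hZ, armCount_succ]
      by_cases hA : A t ω = k
      · by_cases hs : armCount A k t ω < s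
        · have h1 : min (armCount A k t ω + 1) s = min (armCount A k t ω) s + 1 := by omega
          simp only [hA, hs, and_self, if_true, h1, hg₁, mul_zero, zero_add, mul_one, hg, hf]
          rw [← ENNReal.ofReal_mul (Real.exp_nonneg _), ← Real.exp_add]
          congr 2
          push_cast
          ring
        · have h1 : min (armCount A k t ω + 1) s = min (armCount A k t ω) s := by omega
          simp [hA, hs, h1, hg₁, hg]
      · simp [hA, hg]
    have hAm : MeasurableSet {ω | A t ω = k} :=
      hrun.measurable_arm t (measurableSet_singleton k)
    have hmeas : Measurable fun ω =>
        g ω * (if A t ω = k ∧ armCount A k t ω < s then (0 : ℝ≥0∞) else 1) :=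
      (hgm.mono (hrun.past_le t) le_rfl).mul
        (Measurable.ite (hAm.inter (hrun.past_le t _ hn)) measurable_const measurable_const)
    calc _ = ∫⁻ ω, g ω * (if A t ω = k ∧ armCount A k t ω < s then 0 else 1) ∂P +
          ∫⁻ ω, g₁ ω * (if A t ω = k then f (R t ω) else 0) ∂P := by
          rw [lintegral_congr step, lintegral_add_left hmeas]
      _ = ∫⁻ ω, g ω * (if A t ω = k ∧ armCount A k t ω < s then 0 else 1) ∂P +
          ∫⁻ ω, g₁ ω * (if A t ω = k then ∫⁻ x, f x ∂(ν k) else 0) ∂P := by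
          rw [hrun.lintegral_reward t k hg₁m hfm]
      _ ≤ ∫⁻ ω, g ω * (if A t ω = k ∧ armCount A k t ω < s then 0 else 1) ∂P +
          ∫⁻ ω, g₁ ω * (if A t ω = k then 1 else 0) ∂P := by
          gcongr with ω
          split_ifs
          · exact lintegral_exp_sub_le hk l
          · exact le_rfl
      _ = ∫⁻ ω, g ω ∂P := by
          rw [← lintegral_add_left hmeas]
          refine lintegral_congr fun ω => ?_
          by_cases hA : A t ω = k <;> by_cases hs : armCount A k t ω < s <;> simp [hA, hs, hg₁]
      _ ≤ 1 := ih

/-- A sum of `s` rewards of an arm is sub-Gaussian, although the rounds are chosen adaptively. -/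
lemma IsRun.hasSubgaussianMGF_truncSum [IsProbabilityMeasure P] [IsMarkovKernel ν]
    (hrun : IsRun π ν P A R) {k : Fin K} {m : ℝ} {v : ℝ≥0}
    (hk : HasSubgaussianMGF (fun x => x - m) v (ν k)) (s t : ℕ) :
    HasSubgaussianMGF (truncSum A R m k s t) (s * v) P := by
  have hZ := hrun.measurable_truncSum m k s t
  have key : ∀ l : ℝ, ∫⁻ ω, ENNReal.ofReal (Real.exp (l * truncSum A R m k s t ω)) ∂P ≤
      ENNReal.ofReal (Real.exp ((s * v : ℝ≥0) * l ^ 2 / 2)) := by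
    intro l
    calc _ ≤ ∫⁻ ω, ENNReal.ofReal (Real.exp ((s * v : ℝ≥0) * l ^ 2 / 2)) *
            ENNReal.ofReal (Real.exp (l * truncSum A R m k s t ω -
              v * l ^ 2 / 2 * (min (armCount A k t ω) s : ℕ))) ∂P := by
          refine lintegral_mono fun ω => ?_
          rw [← ENNReal.ofReal_mul (Real.exp_nonneg _), ← Real.exp_add]
          refine ENNReal.ofReal_le_ofReal (Real.exp_le_exp.2 ?_)
          -- At most `s` rewards enter the sum, so the random compensator is at most its
          -- deterministic value at `s`.
          have h1 : ((min (armCount A k t ω) s : ℕ) : ℝ) ≤ s := by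
            exact_mod_cast min_le_right _ _
          have h2 : 0 ≤ (v : ℝ) * l ^ 2 / 2 := by positivity
          push_cast at h1 ⊢
          nlinarith [mul_le_mul_of_nonneg_left h1 h2]
      _ ≤ ENNReal.ofReal (Real.exp ((s * v : ℝ≥0) * l ^ 2 / 2)) * 1 := by
          rw [lintegral_const_mul' _ _ ENNReal.ofReal_ne_top]
          gcongr
          exact hrun.lintegral_exp_truncSum_sub_le hk l s t
      _ = _ := mul_one _
  have hmeas : ∀ l : ℝ, AEStronglyMeasurable
      (fun ω => Real.exp (l * truncSum A R m k s t ω)) P := fun l =>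
    (Real.measurable_exp.comp (hZ.const_mul l)).aestronglyMeasurable
  refine ⟨fun l => ⟨hmeas l, ?_⟩, fun l => ?_⟩
  · rw [hasFiniteIntegral_iff_ofReal (ae_of_all _ fun _ => Real.exp_nonneg _)]
    exact (key l).trans_lt ENNReal.ofReal_lt_top
  · rw [mgf, integral_eq_lintegral_of_nonneg_ae (ae_of_all _ fun _ => Real.exp_nonneg _) (hmeas l)]
    exact ENNReal.toReal_le_of_le_ofReal (Real.exp_nonneg _) (key l)

lemma IsRun.measureReal_abs_truncSum_ge [IsProbabilityMeasure P] [IsMarkovKernel ν]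
    (hrun : IsRun π ν P A R) {k : Fin K} {m : ℝ} {v : ℝ≥0} (hv : 0 < v)
    (hk : HasSubgaussianMGF (fun x => x - m) v (ν k)) {x : ℝ} (hx : 0 ≤ x) {s : ℕ} (hs : s ≠ 0)
    (t : ℕ) :
    P.real {ω | Real.sqrt (2 * x * (s * v)) ≤ |truncSum A R m k s t ω|} ≤
      2 * Real.exp (-x) := by
  have hZ := hrun.hasSubgaussianMGF_truncSum hk s t
  have hs' : (0 : ℝ) < s := by exact_mod_cast Nat.pos_of_ne_zero hs
  have hv' : (0 : ℝ) < v := hv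
  have hexp : -(Real.sqrt (2 * x * (s * v))) ^ 2 / (2 * ((s * v : ℝ≥0) : ℝ)) = -x := by
    rw [Real.sq_sqrt (by positivity)]
    push_cast
    field_simp
  have h1 := hZ.measure_ge_le (Real.sqrt_nonneg (2 * x * (s * v)))
  have h2 := hZ.neg.measure_ge_le (Real.sqrt_nonneg (2 * x * (s * v)))
  rw [hexp] at h1 h2
  calc _ ≤ P.real ({ω | Real.sqrt (2 * x * (s * v)) ≤ truncSum A R m k s t ω} ∪
        {ω | Real.sqrt (2 * x * (s * v)) ≤ (-truncSum A R m k s t) ω}) :=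
        measureReal_mono (fun ω (hω : _ ≤ |truncSum A R m k s t ω|) => le_abs.1 hω)
          (measure_ne_top _ _)
    _ ≤ Real.exp (-x) + Real.exp (-x) := (measureReal_union_le _ _).trans (add_le_add h1 h2)
    _ = _ := by ring

/-- With high probability, the empirical mean of an arm is close to the true mean in all rounds in
which the number of pulls of the arm is between `1` and `J`. -/
lemma IsRun.measureReal_exists_deviation_le [IsProbabilityMeasure P] [IsMarkovKernel ν]
    (hrun : IsRun π ν P A R) {k : Fin K} {m : ℝ} {v : ℝ≥0} (hv : 0 < v)
    (hk : HasSubgaussianMGF (fun x => x - m) v (ν k)) {x : ℝ} (hx : 0 ≤ x) (J t : ℕ) :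
    P.real {ω | ∃ i ≤ t, armCount A k i ω ≠ 0 ∧ armCount A k i ω ≤ J ∧
      Real.sqrt (2 * x * v / armCount A k i ω) ≤ |empMean (history A R i ω) k - m|} ≤
      2 * J * Real.exp (-x) := by
  -- The union is over the pull count `s`, not the round `i`: all rounds with the same count share
  -- one truncated sum at time `t`. The cost is `J`, whatever `t` is.
  calc _ ≤ P.real (⋃ s ∈ Finset.Icc 1 J,
        {ω | Real.sqrt (2 * x * (s * v)) ≤ |truncSum A R m k s t ω|}) := by
        refine measureReal_mono (fun ω hω => ?_) (measure_ne_top _ _)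
        obtain ⟨i, hit, h0, hJ, hdev⟩ := hω
        simp only [Set.mem_iUnion, Finset.mem_Icc]
        refine ⟨armCount A k i ω, ⟨Nat.pos_of_ne_zero h0, hJ⟩, ?_⟩
        have hn : (0 : ℝ) < armCount A k i ω := by exact_mod_cast Nat.pos_of_ne_zero h0
        rw [Set.mem_ofPred_eq, truncSum_eq_empMean m hit h0, abs_mul, abs_of_pos hn]
        calc _ = armCount A k i ω * Real.sqrt (2 * x * v / armCount A k i ω) := by
              rw [← Real.sqrt_sq hn.le, ← Real.sqrt_mul (sq_nonneg _), Real.sqrt_sq hn.le]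
              congr 1
              field_simp
          _ ≤ _ := mul_le_mul_of_nonneg_left hdev hn.le
    _ ≤ ∑ s ∈ Finset.Icc 1 J,
        P.real {ω | Real.sqrt (2 * x * (s * v)) ≤ |truncSum A R m k s t ω|} :=
        measureReal_biUnion_finset_le _ _
    _ ≤ ∑ s ∈ Finset.Icc 1 J, 2 * Real.exp (-x) :=
        Finset.sum_le_sum fun s hs => hrun.measureReal_abs_truncSum_ge hv hk hx
          (Nat.one_le_iff_ne_zero.1 (Finset.mem_Icc.1 hs).1) t
    _ = _ := by
        simp
        ring

end Concentration

/-! ### Gaussian tails -/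

lemma hasSubgaussianMGF_gaussianReal (m : ℝ) (v : ℝ≥0) :
    HasSubgaussianMGF (fun x => x - m) v (gaussianReal m v) := by
  have h : ∀ l : ℝ, (fun x => Real.exp (l * (x - m))) =
      fun x => Real.exp (-(l * m)) * Real.exp (l * x) := by
    intro l
    ext x
    rw [← Real.exp_add]
    congr 1
    ring
  refine ⟨fun l => ?_, fun l => ?_⟩
  · rw [h l]
    exact (integrable_exp_mul_gaussianReal l).const_mul _
  · rw [mgf, h l, integral_const_mul]
    have := congrFun (mgf_fun_id_gaussianReal (μ := m) (v := v)) l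
    rw [mgf] at this
    rw [this, ← Real.exp_add]
    refine Real.exp_le_exp.2 (le_of_eq ?_)
    ring

lemma gaussianReal_Ici_le (m : ℝ) (v : ℝ≥0) {d y : ℝ} (hd : 0 ≤ d) (hy : m + d ≤ y) :
    (gaussianReal m v).real (Set.Ici y) ≤ Real.exp (-d ^ 2 / (2 * v)) := by
  refine le_trans (measureReal_mono (fun x hx => ?_) (measure_ne_top _ _))
    ((hasSubgaussianMGF_gaussianReal m v).measure_ge_le hd)
  have hx : y ≤ x := hx
  exact (show d ≤ x - m by linarith)

lemma gaussianReal_Iic_le (m : ℝ) (v : ℝ≥0) {d y : ℝ} (hd : 0 ≤ d) (hy : y ≤ m - d) :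
    (gaussianReal m v).real (Set.Iic y) ≤ Real.exp (-d ^ 2 / (2 * v)) := by
  refine le_trans (measureReal_mono (fun x hx => ?_) (measure_ne_top _ _))
    ((hasSubgaussianMGF_gaussianReal m v).neg.measure_ge_le hd)
  have hx : x ≤ y := hx
  exact (show d ≤ -(x - m) by linarith)

/-- The half-line contains an interval one standard deviation long, from `z` to `z + 1` deviations
above the mean, on which the density is at least its value at the right end. -/
lemma le_gaussianReal_Ici (m : ℝ) {v : ℝ≥0} (hv : v ≠ 0) {z y : ℝ} (hz : 0 ≤ z)
    (hy : y ≤ m + z * Real.sqrt v) :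
    (Real.sqrt (2 * Real.pi))⁻¹ * Real.exp (-(z + 1) ^ 2 / 2) ≤
      (gaussianReal m v).real (Set.Ici y) := by
  have hv0 : (0 : ℝ) < v := by exact_mod_cast pos_iff_ne_zero.2 hv
  set s := Real.sqrt v with hs
  have hs0 : 0 < s := Real.sqrt_pos.2 hv0
  have hsv : s ^ 2 = v := Real.sq_sqrt hv0.le
  set I := Set.Icc (m + z * s) (m + (z + 1) * s) with hI
  have hsub : I ⊆ Set.Ici y := fun x hx => hy.trans hx.1
  refine le_trans ?_ (measureReal_mono hsub (measure_ne_top _ _))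
  rw [measureReal_def, gaussianReal_apply_eq_integral m hv,
    ENNReal.toReal_ofReal (integral_nonneg fun x => gaussianPDFReal_nonneg m v x)]
  have hvol : (volume I).toReal = s := by
    rw [hI, Real.volume_Icc, ENNReal.toReal_ofReal (by nlinarith)]
    ring
  have hlow : ∀ x ∈ I, (Real.sqrt (2 * Real.pi * v))⁻¹ * Real.exp (-(z + 1) ^ 2 / 2) ≤
      gaussianPDFReal m v x := by
    intro x hx
    rw [gaussianPDFReal]
    refine mul_le_mul_of_nonneg_left (Real.exp_le_exp.2 ?_) (by positivity)
    rw [div_le_div_iff₀ (by norm_num) (by positivity)]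
    have h1 : 0 ≤ x - m := by nlinarith [hx.1]
    have h2 : x - m ≤ (z + 1) * s := by linarith [hx.2]
    have h3 : (x - m) ^ 2 ≤ ((z + 1) * s) ^ 2 := pow_le_pow_left₀ h1 h2 2
    rw [mul_pow, hsv] at h3
    nlinarith
  have hint := setIntegral_ge_of_const_le_real (μ := volume) (s := I) measurableSet_Icc
    (by rw [hI, Real.volume_Icc]; exact ENNReal.ofReal_ne_top) hlow
    (integrable_gaussianPDFReal m v).integrableOn
  rw [measureReal_def, hvol] at hint
  refine le_trans (le_of_eq ?_) hint
  rw [Real.sqrt_mul (by positivity) (v : ℝ), ← hs]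
  field_simp

/-! ### One round of the algorithms -/

section Round

variable {K t : ℕ} {Θ : Type*} {μ : Fin K → Θ → ℝ} {θstar : Θ} {kstar : Fin K} {α : ℝ}
  {β σ : ℝ≥0} {h : History K t} {π : Policy K}

lemma mem_candidates_iff (hθ : θstar ∈ confSet μ α σ h) (k : Fin K) :
    k ∈ candidates μ α σ h ↔ CompetitiveOn μ (confSet μ α σ h) k := by
  have : confSet μ α σ h ≠ ∅ := Set.Nonempty.ne_empty ⟨θstar, hθ⟩
  exact ⟨fun hk => hk.resolve_left this, Or.inr⟩

lemma optimal_mem_candidates (hopt : ∀ k, μ k θstar ≤ μ kstar θstar)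
    (hθ : θstar ∈ confSet μ α σ h) : kstar ∈ candidates μ α σ h :=
  Or.inr ⟨θstar, hθ, hopt⟩

lemma competitive_optimal (hopt : ∀ k, μ k θstar ≤ μ kstar θstar) :
    Competitive μ kstar θstar kstar :=
  fun ε hε => ⟨θstar, by simpa [levelNbhd] using hε, hopt⟩

/-- Both `θstar` and any `θ` of the confidence set put the mean of `kstar` within one width of its
empirical mean, hence within `ε` of each other. -/
lemma notMem_candidates {ε : ℝ} {k : Fin K} (hθ : θstar ∈ confSet μ α σ h)
    (hk : ¬ CompetitiveOn μ (levelNbhd μ kstar θstar ε) k) (hn : pulls h kstar ≠ 0)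
    (hw : width α σ h kstar ≤ ε / 2) : k ∉ candidates μ α σ h := by
  rw [mem_candidates_iff hθ]
  rintro ⟨θ, hθ', hmax⟩
  refine hk ⟨θ, ?_, hmax⟩
  have h1 := abs_lt.1 (hθ kstar hn)
  have h2 := abs_lt.1 (hθ' kstar hn)
  have h3 : |μ kstar θstar - μ kstar θ| < ε :=
    abs_lt.2 ⟨by linarith [h1.1, h2.2], by linarith [h1.2, h2.1]⟩
  exact h3

instance : IsProbabilityMeasure (tsLaw β σ h) := by
  unfold tsLaw
  infer_instance

lemma tsLaw_preimage (k : Fin K) {s : Set ℝ} (hs : MeasurableSet s) :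
    tsLaw β σ h {S | S k ∈ s} =
      gaussianReal (empMean h k) (β * σ ^ 2 / (pulls h k : ℝ≥0)) s :=
  (measurePreserving_eval (fun k => gaussianReal (empMean h k)
    (β * σ ^ 2 / (pulls h k : ℝ≥0))) k).measure_preimage hs.nullMeasurableSet

/-- The sample of one arm is independent of the event that no other arm of `C` has a sample
above `y`. -/
lemma tsLaw_inter_box (C : Set (Fin K)) (k : Fin K) (y : ℝ) :
    tsLaw β σ h {S | y ≤ S k ∧ ∀ j ∈ C, j ≠ k → S j ≤ y} =
      gaussianReal (empMean h k) (β * σ ^ 2 / (pulls h k : ℝ≥0)) (Set.Ici y) *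
        tsLaw β σ h {S | ∀ j ∈ C, j ≠ k → S j ≤ y} := by
  classical
  set s : Fin K → Set ℝ := fun j => if j ∈ C ∧ j ≠ k then Set.Iic y else Set.univ with hs
  have h1 : {S : Fin K → ℝ | ∀ j ∈ C, j ≠ k → S j ≤ y} = Set.univ.pi s := by
    ext S
    simp only [hs, Set.mem_univ_pi, Set.mem_ofPred_eq]
    refine forall_congr' fun j => ?_
    by_cases hj : j ∈ C ∧ j ≠ k
    · simp [hj]
    · rw [if_neg hj]
      simpa using fun a b => absurd ⟨a, b⟩ hj
  -- Both events are boxes differing only in coordinate `k`, so the product measure factors.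
  have h2 : {S : Fin K → ℝ | y ≤ S k ∧ ∀ j ∈ C, j ≠ k → S j ≤ y} =
      Set.univ.pi (fun j => if j = k then Set.Ici y else s j) := by
    ext S
    have h1' : (∀ j ∈ C, j ≠ k → S j ≤ y) ↔ S ∈ Set.univ.pi s := by rw [← h1]; rfl
    simp only [Set.mem_ofPred_eq, h1', Set.mem_univ_pi]
    constructor
    · rintro ⟨ha, hb⟩ j
      by_cases hj : j = k
      · subst hj; simpa using ha
      · simpa [hj] using hb j
    · intro ha
      refine ⟨by simpa using ha k, fun j => ?_⟩
      by_cases hj : j = k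
      · simp [hs, hj]
      · simpa [hj] using ha j
  rw [h1, h2, tsLaw, Measure.pi_pi, Measure.pi_pi,
    ← Finset.mul_prod_erase _ _ (Finset.mem_univ k), if_pos rfl]
  congr 1
  rw [← Finset.mul_prod_erase _ (fun j => gaussianReal (empMean h j)
    (β * σ ^ 2 / (pulls h j : ℝ≥0)) (s j)) (Finset.mem_univ k)]
  have : s k = Set.univ := by simp [hs]
  rw [this, measure_univ, one_mul]
  refine Finset.prod_congr rfl fun j hj => ?_
  rw [if_neg (Finset.ne_of_mem_erase hj)]

lemma IsTSC.mem_candidates (hπ : IsTSC μ α β σ π) {k : Fin K} (hk : π t h {k} ≠ 0) :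
    k ∈ candidates μ α σ h := by
  by_cases hu : ∃ k ∈ candidates μ α σ h, pulls h k = 0
  · exact ((hπ t h).1 hu k hk).1
  · push Not at hu
    by_contra hc
    exact hk (((hπ t h).2 hu).2 k hc)

/-- An arm that has been pulled before is pulled by a TS-C policy only in rounds in which the
Thompson samples decide. -/
lemma IsTSC.apply_eq_zero_or (hπ : IsTSC μ α β σ π) {k : Fin K} (hk : pulls h k ≠ 0) :
    π t h {k} = 0 ∨ (∀ j ∈ candidates μ α σ h, π t h {j} =
        tsLaw β σ h {S | ∀ i ∈ candidates μ α σ h, S i ≤ S j}) ∧ k ∈ candidates μ α σ h := by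
  by_cases h0 : π t h {k} = 0
  · exact Or.inl h0
  refine Or.inr ⟨?_, hπ.mem_candidates h0⟩
  have hu : ¬ ∃ k ∈ candidates μ α σ h, pulls h k = 0 := fun hu =>
    hk ((hπ t h).1 hu k h0).2
  push Not at hu
  exact ((hπ t h).2 hu).1

lemma IsTSC.apply_eq_zero (hπ : IsTSC μ α β σ π) {k : Fin K} (hk : pulls h k ≠ 0)
    (hstar : kstar ∈ candidates μ α σ h) (h0 : pulls h kstar = 0) : π t h {k} = 0 := by
  by_contra hne
  exact hk ((hπ t h).1 ⟨kstar, hstar, h0⟩ k hne).2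

/-- To win, the sample of `k` must reach that of `kstar`; then either the former is above `y` or the
latter is below. -/
lemma IsTSC.apply_le_add (hπ : IsTSC μ α β σ π) {k : Fin K} (hk : pulls h k ≠ 0)
    (hstar : kstar ∈ candidates μ α σ h) (y : ℝ) :
    π t h {k} ≤ gaussianReal (empMean h k) (β * σ ^ 2 / (pulls h k : ℝ≥0)) (Set.Ici y) +
      gaussianReal (empMean h kstar) (β * σ ^ 2 / (pulls h kstar : ℝ≥0)) (Set.Iic y) := by
  rcases hπ.apply_eq_zero_or hk with h0 | ⟨hlaw, hkC⟩
  · rw [h0]; exact zero_le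
  · rw [hlaw k hkC, ← tsLaw_preimage k measurableSet_Ici,
      ← tsLaw_preimage kstar measurableSet_Iic]
    refine (measure_mono fun S hS => ?_).trans (measure_union_le _ _)
    have hS : S kstar ≤ S k := hS kstar hstar
    rcases le_total y (S k) with hy | hy
    · exact Or.inl hy
    · exact Or.inr (hS.trans hy)

/-- The probabilities of pulling an arm `l` and the optimal arm compare as long as the sample of
`l` is below a level `y` that the sample of the optimal arm may exceed. -/
lemma IsTSC.mul_apply_le (hπ : IsTSC μ α β σ π) {l : Fin K} (hl : pulls h l ≠ 0)
    (hstar : kstar ∈ candidates μ α σ h) (y : ℝ) :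
    gaussianReal (empMean h kstar) (β * σ ^ 2 / (pulls h kstar : ℝ≥0)) (Set.Ici y) * π t h {l} ≤
      gaussianReal (empMean h l) (β * σ ^ 2 / (pulls h l : ℝ≥0)) (Set.Ici y) +
        π t h {kstar} := by
  rcases hπ.apply_eq_zero_or hl with h0 | ⟨hlaw, hlC⟩
  · rw [h0, mul_zero]; exact zero_le
  set C := candidates μ α σ h
  have h1 : π t h {l} ≤
      gaussianReal (empMean h l) (β * σ ^ 2 / (pulls h l : ℝ≥0)) (Set.Ici y) +
        tsLaw β σ h {S | ∀ j ∈ C, j ≠ kstar → S j ≤ y} := by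
    rw [hlaw l hlC, ← tsLaw_preimage l measurableSet_Ici]
    refine (measure_mono fun S hS => ?_).trans (measure_union_le _ _)
    rcases le_total y (S l) with hy | hy
    · exact Or.inl hy
    · exact Or.inr fun j hj _ => (hS j hj).trans hy
  -- If all other candidates stay below `y`, a sample of `kstar` above `y` wins, and it is
  -- independent of the others.
  have h2 : gaussianReal (empMean h kstar) (β * σ ^ 2 / (pulls h kstar : ℝ≥0)) (Set.Ici y) *
      tsLaw β σ h {S | ∀ j ∈ C, j ≠ kstar → S j ≤ y} ≤ π t h {kstar} := by
    rw [← tsLaw_inter_box, hlaw kstar hstar]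
    refine measure_mono fun S hS j hj => ?_
    by_cases hjk : j = kstar
    · rw [hjk]
    · exact (hS.2 j hj hjk).trans hS.1
  calc _ ≤ gaussianReal (empMean h kstar) (β * σ ^ 2 / (pulls h kstar : ℝ≥0)) (Set.Ici y) *
        (gaussianReal (empMean h l) (β * σ ^ 2 / (pulls h l : ℝ≥0)) (Set.Ici y) +
          tsLaw β σ h {S | ∀ j ∈ C, j ≠ kstar → S j ≤ y}) := by gcongr
    _ ≤ 1 * gaussianReal (empMean h l) (β * σ ^ 2 / (pulls h l : ℝ≥0)) (Set.Ici y) +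
        π t h {kstar} := by
      rw [mul_add]
      gcongr
      exact prob_le_one
    _ = _ := by rw [one_mul]

end Round

/-! ### Consequences for a run -/

section Run

variable {Ω : Type*} [MeasurableSpace Ω] {K : ℕ} {π : Policy K} {ν : Kernel (Fin K) ℝ}
  {P : Measure Ω} {A : ℕ → Ω → Fin K} {R : ℕ → Ω → ℝ}

/-- Transfers support conditions on the policy to the arms actually pulled, by testing the
conditional law against the event that `π` gives `k` mass zero. -/
lemma IsRun.ae_apply_ne_zero [IsProbabilityMeasure P] [∀ t, IsMarkovKernel (π t)]
    (hrun : IsRun π ν P A R) :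
    ∀ᵐ ω ∂P, ∀ t, π t (history A R t ω) {A t ω} ≠ 0 := by
  have h1 : ∀ t k, ∀ᵐ ω ∂P, A t ω = k → π t (history A R t ω) {k} ≠ 0 := by
    intro t k
    set g : Ω → ℝ≥0∞ := fun ω => if π t (history A R t ω) {k} = 0 then 1 else 0 with hg
    have hgm : Measurable[past A R t] g :=
      (Measurable.ite (((π t).measurable_coe (measurableSet_singleton k))
        (measurableSet_singleton 0)) measurable_const measurable_const).comp
        (comap_measurable (history A R t))
    have h2 := hrun.lintegral_arm t k hgm
    have h3 : ∀ ω, g ω * π t (history A R t ω) {k} = 0 := by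
      intro ω
      by_cases h : π t (history A R t ω) {k} = 0 <;> simp [hg, h]
    simp only [h3, lintegral_zero] at h2
    rw [lintegral_eq_zero_iff] at h2
    · filter_upwards [h2] with ω hω hA h0
      simp [hg, hA, h0] at hω
    · exact (hgm.mono (hrun.past_le t) le_rfl).mul
        (Measurable.ite (hrun.measurable_arm t (measurableSet_singleton k)) measurable_const
          measurable_const)
  have h2 : ∀ᵐ ω ∂P, ∀ t k, A t ω = k → π t (history A R t ω) {k} ≠ 0 :=
    ae_all_iff.2 fun t => ae_all_iff.2 fun k => h1 t k
  filter_upwards [h2] with ω hω t using hω t _ rfl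

/-- The probability to pull an arm on an event of the past is bounded by a uniform bound on the
probability with which the policy pulls it there. -/
lemma IsRun.measureReal_inter_le [IsProbabilityMeasure P] [∀ t, IsMarkovKernel (π t)]
    (hrun : IsRun π ν P A R) (t : ℕ) (k : Fin K) {B : Set Ω} (hB : MeasurableSet[past A R t] B)
    {c : ℝ} (hc : 0 ≤ c) (h : ∀ ω ∈ B, (π t (history A R t ω)).real {k} ≤ c) :
    P.real {ω | A t ω = k ∧ ω ∈ B} ≤ c := by
  have hgm : Measurable[past A R t] (B.indicator (1 : Ω → ℝ≥0∞)) :=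
    measurable_const.indicator hB
  have h1 := hrun.lintegral_arm t k hgm
  have hm : MeasurableSet {ω | A t ω = k ∧ ω ∈ B} :=
    (hrun.measurable_arm t (measurableSet_singleton k)).inter (hrun.past_le t _ hB)
  have h2 : P {ω | A t ω = k ∧ ω ∈ B} =
      ∫⁻ ω, B.indicator (1 : Ω → ℝ≥0∞) ω * (if A t ω = k then 1 else 0) ∂P := by
    rw [← lintegral_indicator_one hm]
    refine lintegral_congr fun ω => ?_
    by_cases hA : A t ω = k <;> by_cases hω : ω ∈ B <;> simp [hA, hω]
  refine ENNReal.toReal_le_of_le_ofReal hc ?_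
  rw [h2, h1]
  calc _ ≤ ∫⁻ ω, ENNReal.ofReal c ∂P := by
        refine lintegral_mono fun ω => ?_
        by_cases hω : ω ∈ B
        · rw [Set.indicator_of_mem hω, Pi.one_apply, one_mul]
          exact (ENNReal.le_ofReal_iff_toReal_le (measure_ne_top _ _) hc).2 (h ω hω)
        · simp [hω]
    _ = _ := by simp

/-- The expectation of a potential that grows with the pulls of `l` in the rounds of `B` and
decreases with the pulls of `k`. -/
lemma IsRun.lintegral_potential_le [IsProbabilityMeasure P] [∀ t, IsMarkovKernel (π t)]
    (hrun : IsRun π ν P A R) {k l : Fin K} (hne : l ≠ k) {B : ℕ → Set Ω}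
    (hB : ∀ i, MeasurableSet[past A R i] (B i)) [∀ i, DecidablePred (· ∈ B i)] {q η : ℝ≥0} (t : ℕ)
    (h : ∀ i < t, ∀ ω ∈ B i, q * π i (history A R i ω) {l} ≤
      η + 2⁻¹ * π i (history A R i ω) {k}) :
    ∫⁻ ω, (1 + q : ℝ≥0∞) ^ (∑ i ∈ Finset.range t, if A i ω = l ∧ ω ∈ B i then 1 else 0) *
      2⁻¹ ^ armCount A k t ω ∂P ≤ (1 + η : ℝ≥0∞) ^ t := by
  induction t with
  | zero => simp
  | succ t ih =>
    have ih := ih fun i hi => h i (hi.trans (Nat.lt_succ_self t))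
    set u : ℕ → Ω → ℕ := fun t ω =>
      ∑ i ∈ Finset.range t, if A i ω = l ∧ ω ∈ B i then 1 else 0 with hu
    set Φ : ℕ → Ω → ℝ≥0∞ := fun t ω => (1 + q : ℝ≥0∞) ^ u t ω * 2⁻¹ ^ armCount A k t ω with hΦ
    have hum : ∀ t, Measurable[past A R t] (u t) := fun t => by
      refine Finset.measurable_fun_sum _ fun i hi => ?_
      have hi := Finset.mem_range.1 hi
      have hle : past A R i ≤ past A R t := by
        have h1 : Measurable fun x : History K t => fun j : Fin i => x (Fin.castLE hi.le j) :=
          measurable_pi_iff.2 fun j => measurable_pi_apply _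
        exact (h1.comp (comap_measurable (history A R t))).comap_le
      exact Measurable.ite ((measurableSet_arm_past hi l).inter (hle _ (hB i)))
        measurable_const measurable_const
    have hΦm : ∀ t, Measurable[past A R t] (Φ t) := fun t =>
      ((measurable_from_top (f := fun n : ℕ => (1 + q : ℝ≥0∞) ^ n)).comp (hum t)).mul
        ((measurable_from_top (f := fun n : ℕ => (2⁻¹ : ℝ≥0∞) ^ n)).comp
          (measurable_armCount_past le_rfl k))
    have hΦm' : ∀ t, Measurable (Φ t) := fun t => (hΦm t).mono (hrun.past_le t) le_rfl
    set g : Ω → ℝ≥0∞ := fun ω => q * Φ t ω * (if ω ∈ B t then 1 else 0) with hg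
    have hgm : Measurable[past A R t] g :=
      ((hΦm t).const_mul (q : ℝ≥0∞)).mul (Measurable.ite (hB t) measurable_const measurable_const)
    -- A pull of `l` in `B` adds `q * Φ`, a pull of `k` removes `Φ / 2`. The loss stands on the left
    -- because subtraction in `ℝ≥0∞` truncates; `hfin` later allows cancelling it.
    have step : ∀ ω, Φ (t + 1) ω + (2⁻¹ * Φ t ω) * (if A t ω = k then 1 else 0) =
        Φ t ω + g ω * (if A t ω = l then 1 else 0) := by
      intro ω
      have h1 : u (t + 1) ω = u t ω + if A t ω = l ∧ ω ∈ B t then 1 else 0 :=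
        Finset.sum_range_succ _ _
      simp only [hΦ, h1, armCount_succ, hg]
      by_cases hk : A t ω = k
      · have hl : A t ω ≠ l := fun hl => hne (hl.symm.trans hk)
        simp only [hk, hk ▸ hl, false_and, if_true, if_false, add_zero, mul_one, mul_zero]
        rw [pow_succ, ← mul_assoc, mul_comm _ (2⁻¹ : ℝ≥0∞), ← add_mul, ENNReal.inv_two_add_inv_two,
          one_mul]
      · by_cases hl : A t ω = l
        · by_cases hBt : ω ∈ B t
          · simp only [hl, hBt, and_self, if_true, hne, if_false, add_zero, mul_one, mul_zero]
            ring
          · simp [hl, hBt, hne]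
        · simp [hk, hl]
    have hAm : ∀ j, Measurable fun ω => if A t ω = j then (1 : ℝ≥0∞) else 0 := fun j =>
      Measurable.ite (hrun.measurable_arm t (measurableSet_singleton j)) measurable_const
        measurable_const
    have hsum : ∫⁻ ω, Φ (t + 1) ω ∂P + ∫⁻ ω, 2⁻¹ * Φ t ω * π t (history A R t ω) {k} ∂P =
        ∫⁻ ω, Φ t ω ∂P + ∫⁻ ω, g ω * π t (history A R t ω) {l} ∂P := by
      rw [← hrun.lintegral_arm t k ((hΦm t).const_mul _), ← hrun.lintegral_arm t l hgm,
        ← lintegral_add_left (hΦm' _), ← lintegral_add_left (hΦm' _)]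
      exact lintegral_congr step
    have hle : ∫⁻ ω, g ω * π t (history A R t ω) {l} ∂P ≤
        η * ∫⁻ ω, Φ t ω ∂P + ∫⁻ ω, 2⁻¹ * Φ t ω * π t (history A R t ω) {k} ∂P := by
      rw [← lintegral_const_mul _ (hΦm' t), ← lintegral_add_left ((hΦm' t).const_mul _)]
      refine lintegral_mono fun ω => ?_
      by_cases hω : ω ∈ B t
      · simp only [hg, hω, if_true, mul_one]
        calc _ = Φ t ω * (q * π t (history A R t ω) {l}) := by ring
          _ ≤ Φ t ω * (η + 2⁻¹ * π t (history A R t ω) {k}) := by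
            gcongr
            exact h t (Nat.lt_succ_self t) ω hω
          _ = _ := by ring
      · simp [hg, hω]
    have hfin : ∫⁻ ω, 2⁻¹ * Φ t ω * π t (history A R t ω) {k} ∂P ≠ ∞ := by
      refine ne_top_of_le_ne_top ?_ (lintegral_mono (g := fun ω => Φ t ω) fun ω => ?_)
      · exact ne_top_of_le_ne_top (ENNReal.pow_ne_top (by simp)) ih
      · calc 2⁻¹ * Φ t ω * π t (history A R t ω) {k} ≤ 1 * Φ t ω * 1 := by
              gcongr
              · exact ENNReal.inv_le_one.2 (by norm_num)
              · exact prob_le_one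
          _ = Φ t ω := by ring
    have hfinal : ∫⁻ ω, Φ (t + 1) ω ∂P ≤ ∫⁻ ω, Φ t ω ∂P + η * ∫⁻ ω, Φ t ω ∂P := by
      refine (ENNReal.add_le_add_iff_right hfin).1 ?_
      rw [hsum, add_assoc]
      gcongr
    calc ∫⁻ ω, Φ (t + 1) ω ∂P ≤ (1 + η) * ∫⁻ ω, Φ t ω ∂P := by rwa [add_mul, one_mul]
      _ ≤ (1 + η) * (1 + η) ^ t := by gcongr
      _ = _ := (pow_succ' _ _).symm

/-- If, in the rounds of `B`, the probability of pulling `l` is not much larger than that of pulling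
`k`, then it is unlikely that `l` is pulled often in these rounds and `k` is pulled rarely. -/
lemma IsRun.measureReal_rare_le [IsProbabilityMeasure P] [∀ t, IsMarkovKernel (π t)]
    (hrun : IsRun π ν P A R) {k l : Fin K} (hne : l ≠ k) {B : ℕ → Set Ω}
    (hB : ∀ i, MeasurableSet[past A R i] (B i)) [∀ i, DecidablePred (· ∈ B i)] {q η : ℝ≥0}
    (t J N : ℕ) (h : ∀ i < t, ∀ ω ∈ B i, q * π i (history A R i ω) {l} ≤
      η + 2⁻¹ * π i (history A R i ω) {k}) :
    P.real {ω | N ≤ (∑ i ∈ Finset.range t, if A i ω = l ∧ ω ∈ B i then 1 else 0) ∧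
      armCount A k t ω ≤ J} ≤ (1 + η : ℝ) ^ t * 2 ^ J / (1 + q : ℝ) ^ N := by
  have h1 := hrun.lintegral_potential_le hne hB t h
  -- On the event the potential is at least `c`, so Markov's inequality applies.
  set c : ℝ≥0∞ := (1 + q : ℝ≥0∞) ^ N * 2⁻¹ ^ J with hc
  have hc_ne : c ≠ 0 := mul_ne_zero (pow_ne_zero _ (by simp)) (pow_ne_zero _ (by simp))
  have hc_top : c ≠ ∞ := ENNReal.mul_ne_top (ENNReal.pow_ne_top (by simp))
    (ENNReal.pow_ne_top (by simp))
  have h2 : P {ω | N ≤ (∑ i ∈ Finset.range t, if A i ω = l ∧ ω ∈ B i then 1 else 0) ∧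
      armCount A k t ω ≤ J} ≤ (1 + η : ℝ≥0∞) ^ t / c := by
    refine (measure_mono fun ω hω => ?_).trans ((meas_ge_le_lintegral_div ?_ hc_ne hc_top).trans
      (ENNReal.div_le_div_right h1 c))
    · exact mul_le_mul' (pow_le_pow_right₀ (by simp) hω.1)
        (pow_le_pow_right_of_le_one' (ENNReal.inv_le_one.2 (by norm_num)) hω.2)
    · have hu : Measurable fun ω =>
          ∑ i ∈ Finset.range t, if A i ω = l ∧ ω ∈ B i then 1 else 0 := by
        refine Finset.measurable_fun_sum _ fun i _ => ?_
        exact Measurable.ite ((hrun.measurable_arm i (measurableSet_singleton l)).inter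
          (hrun.past_le i _ (hB i))) measurable_const measurable_const
      exact (((measurable_from_top (f := fun n : ℕ => (1 + q : ℝ≥0∞) ^ n)).comp hu).mul
        ((measurable_from_top (f := fun n : ℕ => (2⁻¹ : ℝ≥0∞) ^ n)).comp
          (hrun.measurable_armCount k t))).aemeasurable
  have h3 := ENNReal.toReal_mono (ENNReal.div_ne_top (ENNReal.pow_ne_top (by simp)) hc_ne) h2
  refine h3.trans (le_of_eq ?_)
  rw [hc, ENNReal.toReal_div, ENNReal.toReal_mul, ENNReal.toReal_pow, ENNReal.toReal_pow,
    ENNReal.toReal_pow, ENNReal.toReal_add (by simp) (by simp),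
    ENNReal.toReal_add (by simp) (by simp), ENNReal.toReal_inv]
  simp
  field_simp

end Run

open Filter Topology

/-! ### Events with summable probabilities -/

/-- A run of a policy of the class `Q` in the bandit model. -/
structure IsBanditRun {Ω : Type*} [MeasurableSpace Ω] {K : ℕ} {Θ : Type*} (μ : Fin K → Θ → ℝ)
    (θstar : Θ) (σ : ℝ≥0) (Q : Policy K → Prop) (π : Policy K) (ν : Kernel (Fin K) ℝ)
    (P : Measure Ω) (A : ℕ → Ω → Fin K) (R : ℕ → Ω → ℝ) : Prop where
  markov_reward : IsMarkovKernel ν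
  reward : IsRewardLaw μ θstar σ ν
  markov_policy : ∀ t, IsMarkovKernel (π t)
  policy : Q π
  prob : IsProbabilityMeasure P
  run : IsRun π ν P A R

/-- The probabilities of the events `E t` are bounded by a summable sequence, uniformly over all
runs of policies of the class `Q`. -/
def SummablyRare.{u} {K : ℕ} {Θ : Type*} (μ : Fin K → Θ → ℝ) (θstar : Θ) (σ : ℝ≥0)
    (Q : Policy K → Prop)
    (E : ∀ Ω : Type u, Policy K → (ℕ → Ω → Fin K) → (ℕ → Ω → ℝ) → ℕ → Set Ω) : Prop :=
  ∃ f : ℕ → ℝ, Summable f ∧ (∀ t, 0 ≤ f t) ∧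
    ∀ (Ω : Type u) [MeasurableSpace Ω] (π : Policy K) (ν : Kernel (Fin K) ℝ) (P : Measure Ω)
      (A : ℕ → Ω → Fin K) (R : ℕ → Ω → ℝ), IsBanditRun μ θstar σ Q π ν P A R →
      ∀ t, P.real (E Ω π A R t) ≤ f t

section SummablyRare

universe u

variable {K : ℕ} {Θ : Type*} {μ : Fin K → Θ → ℝ} {θstar : Θ} {σ : ℝ≥0} {Q : Policy K → Prop}
  {E E' : ∀ Ω : Type u, Policy K → (ℕ → Ω → Fin K) → (ℕ → Ω → ℝ) → ℕ → Set Ω}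

lemma SummablyRare.of_eventually_le {f : ℕ → ℝ} (hf : Summable f)
    (h : ∀ᶠ t in atTop, ∀ (Ω : Type u) [MeasurableSpace Ω] (π : Policy K)
      (ν : Kernel (Fin K) ℝ) (P : Measure Ω) (A : ℕ → Ω → Fin K) (R : ℕ → Ω → ℝ),
      IsBanditRun μ θstar σ Q π ν P A R → P.real (E Ω π A R t) ≤ f t) :
    SummablyRare μ θstar σ Q E := by
  obtain ⟨t₀, ht₀⟩ := eventually_atTop.1 h
  -- The finitely many early times are covered by the trivial bound `1`.
  refine ⟨fun t => |f t| + if t < t₀ then 1 else 0, hf.abs.add ?_, fun t => by positivity, ?_⟩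
  · refine summable_of_ne_finset_zero (s := Finset.range t₀) fun t ht => ?_
    simpa using ht
  · intro Ω _ π ν P A R hrun t
    have := hrun.prob
    change P.real (E Ω π A R t) ≤ |f t| + if t < t₀ then 1 else 0
    by_cases ht : t < t₀
    · rw [if_pos ht]
      exact measureReal_le_one.trans (by linarith [abs_nonneg (f t)])
    · rw [if_neg ht, add_zero]
      exact (ht₀ t (not_lt.1 ht) Ω π ν P A R hrun).trans (le_abs_self _)

lemma SummablyRare.mono (hE : SummablyRare μ θstar σ Q E')
    (h : ∀ᶠ t in atTop, ∀ (Ω : Type u) [MeasurableSpace Ω] (π : Policy K)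
      (ν : Kernel (Fin K) ℝ) (P : Measure Ω) (A : ℕ → Ω → Fin K) (R : ℕ → Ω → ℝ),
      IsBanditRun μ θstar σ Q π ν P A R → ∀ᵐ ω ∂P, ω ∈ E Ω π A R t → ω ∈ E' Ω π A R t) :
    SummablyRare μ θstar σ Q E := by
  obtain ⟨f, hf, -, hfE⟩ := hE
  refine SummablyRare.of_eventually_le hf ?_
  filter_upwards [h] with t ht Ω _ π ν P A R hrun
  have := hrun.prob
  refine le_trans ?_ (hfE Ω π ν P A R hrun t)
  exact ENNReal.toReal_mono (measure_ne_top _ _) (measure_mono_ae (ht Ω π ν P A R hrun))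

lemma SummablyRare.union (hE : SummablyRare μ θstar σ Q E) (hE' : SummablyRare μ θstar σ Q E') :
    SummablyRare μ θstar σ Q fun Ω π A R t => E Ω π A R t ∪ E' Ω π A R t := by
  obtain ⟨f, hf, hf0, hfE⟩ := hE
  obtain ⟨f', hf', hf0', hfE'⟩ := hE'
  exact ⟨fun t => f t + f' t, hf.add hf', fun t => add_nonneg (hf0 t) (hf0' t),
    fun Ω _ π ν P A R hrun t => (measureReal_union_le _ _).trans
      (add_le_add (hfE Ω π ν P A R hrun t) (hfE' Ω π ν P A R hrun t))⟩

lemma SummablyRare.iUnion {ι : Type*} [Fintype ι]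
    {E : ι → ∀ Ω : Type u, Policy K → (ℕ → Ω → Fin K) → (ℕ → Ω → ℝ) → ℕ → Set Ω}
    (hE : ∀ i, SummablyRare μ θstar σ Q (E i)) :
    SummablyRare μ θstar σ Q fun Ω π A R t => ⋃ i, E i Ω π A R t := by
  choose f hf hf0 hfE using hE
  refine ⟨fun t => ∑ i, f i t, summable_sum fun i _ => hf i,
    fun t => Finset.sum_nonneg fun i _ => hf0 i t, fun Ω _ π ν P A R hrun t => ?_⟩
  have := hrun.prob
  exact (measureReal_iUnion_fintype_le _).trans
    (Finset.sum_le_sum fun i _ => hfE i Ω π ν P A R hrun t)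

lemma mul_exp_neg_mul_log (a : ℝ) (ha : 1 < a) (t : ℕ) :
    (t : ℝ) * Real.exp (-(a * Real.log t)) = (t : ℝ) ^ (1 - a) := by
  rcases Nat.eq_zero_or_pos t with rfl | ht
  · rw [Nat.cast_zero, zero_mul, Real.zero_rpow (by linarith)]
  · have ht : (0 : ℝ) < t := by exact_mod_cast ht
    rw [Real.rpow_def_of_pos ht, ← Real.exp_log ht, ← Real.exp_add, Real.exp_log ht]
    congr 1
    ring

/-- Deviations of the empirical means by more than the confidence width of level `a > 2`, in any
of the first `t` rounds, are rare. -/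
lemma summablyRare_deviation (hσ : 0 < σ) {a : ℝ} (ha : 2 < a) :
    SummablyRare.{u} μ θstar σ Q fun _ _ A R t => {ω | ∃ k, ∃ i ≤ t, armCount A k i ω ≠ 0 ∧
      Real.sqrt (2 * (a * Real.log t) * (σ : ℝ) ^ 2 / armCount A k i ω) ≤
        |empMean (history A R i ω) k - μ k θstar|} := by
  -- For each of `K` arms there are at most `t` pull counts, each failing with probability at most
  -- `2 t ^ (-a)`. Summability needs `a > 2`.
  refine SummablyRare.of_eventually_le (f := fun t : ℕ => K * (2 * (t : ℝ) ^ (1 - a)))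
    (((Real.summable_nat_rpow.2 (by linarith)).mul_left 2).mul_left _)
    (Eventually.of_forall ?_)
  intro t Ω _ π ν P A R hrun
  have := hrun.prob
  have := hrun.markov_reward
  have hx : 0 ≤ a * Real.log t := mul_nonneg (by linarith) (Real.log_natCast_nonneg t)
  have h1 : ∀ k, P.real {ω | ∃ i ≤ t, armCount A k i ω ≠ 0 ∧ armCount A k i ω ≤ t ∧
      Real.sqrt (2 * (a * Real.log t) * (σ ^ 2 : ℝ≥0) / armCount A k i ω) ≤
        |empMean (history A R i ω) k - μ k θstar|} ≤ 2 * (t : ℝ) ^ (1 - a) := by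
    intro k
    refine (hrun.run.measureReal_exists_deviation_le (by positivity) (hrun.reward k).2 hx t
      t).trans (le_of_eq ?_)
    rw [mul_assoc, mul_exp_neg_mul_log a (by linarith)]
  calc _ ≤ P.real (⋃ k, {ω | ∃ i ≤ t, armCount A k i ω ≠ 0 ∧ armCount A k i ω ≤ t ∧
        Real.sqrt (2 * (a * Real.log t) * (σ ^ 2 : ℝ≥0) / armCount A k i ω) ≤
        |empMean (history A R i ω) k - μ k θstar|}) := by
        refine measureReal_mono ?_ (measure_ne_top _ _)
        rintro ω ⟨k, i, hi, h0, hdev⟩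
        refine Set.mem_iUnion.2 ⟨k, i, hi, h0, (armCount_le i).trans hi, ?_⟩
        simpa using hdev
    _ ≤ ∑ k : Fin K, 2 * (t : ℝ) ^ (1 - a) :=
        (measureReal_iUnion_fintype_le _).trans (Finset.sum_le_sum fun k _ => h1 k)
    _ = _ := by simp

lemma mem_confSet_history {α : ℝ} {Ω : Type*} {A : ℕ → Ω → Fin K} {R : ℕ → Ω → ℝ} {t : ℕ}
    {ω : Ω} {θ : Θ} : θ ∈ confSet μ α σ (history A R t ω) ↔ ∀ k, armCount A k t ω ≠ 0 →
      |μ k θ - empMean (history A R t ω) k| <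
        Real.sqrt (2 * α * (σ : ℝ) ^ 2 * Real.log t / armCount A k t ω) := by
  simp only [confSet, width, pulls_history, Set.mem_ofPred_eq]

lemma summablyRare_notMem_confSet (hσ : 0 < σ) {α : ℝ} (hα : 2 < α) :
    SummablyRare.{u} μ θstar σ Q
      fun _ _ A R t => {ω | θstar ∉ confSet μ α σ (history A R t ω)} := by
  refine (summablyRare_deviation hσ hα).mono (Eventually.of_forall ?_)
  intro t Ω _ π ν P A R hrun
  refine ae_of_all _ fun ω hω => ?_
  rw [Set.mem_ofPred_eq, mem_confSet_history] at hω
  push Not at hω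
  obtain ⟨k, h0, hdev⟩ := hω
  refine ⟨k, t, le_rfl, h0, ?_⟩
  rw [abs_sub_comm, show 2 * (α * Real.log t) * (σ : ℝ) ^ 2 = 2 * α * (σ : ℝ) ^ 2 * Real.log t by
    ring]
  exact hdev

/-- Non-competitive arms are rarely pulled by a policy that chooses among the candidates and pulls
the optimal arm sufficiently often. -/
lemma summablyRare_of_not_competitive (hσ : 0 < σ) {α : ℝ} (hα : 2 < α) {kstar k : Fin K}
    (hQ : ∀ π, Q π → ∀ t (h : History K t) k, π t h {k} ≠ 0 → k ∈ candidates μ α σ h)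
    (hM : ∀ M : ℝ, 0 < M → SummablyRare.{u} μ θstar σ Q
      fun _ _ A _ t => {ω | (armCount A kstar t ω : ℝ) < M * Real.log t})
    (hk : ¬ Competitive μ kstar θstar k) :
    SummablyRare.{u} μ θstar σ Q fun _ _ A _ t => {ω | A t ω = k} := by
  unfold Competitive at hk
  push Not at hk
  obtain ⟨ε, hε, hk⟩ := hk
  have hσ' : (0 : ℝ) < σ := hσ
  -- With `M log t` pulls the width is exactly `ε / 2`.
  set M : ℝ := 8 * α * σ ^ 2 / ε ^ 2 with hMdef
  have hM0 : 0 < M := by positivity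
  refine ((summablyRare_notMem_confSet hσ hα).union (hM M hM0)).mono ?_
  filter_upwards [eventually_ge_atTop 2] with t ht Ω _ π ν P A R hrun
  have := hrun.prob
  have := hrun.markov_policy
  filter_upwards [hrun.run.ae_apply_ne_zero] with ω hω hA
  by_contra hcon
  simp only [Set.mem_union, Set.mem_ofPred_eq, not_or, not_not, not_lt] at hcon hA
  have hlog : 0 < Real.log t := Real.log_pos (by exact_mod_cast ht)
  have hn : (0 : ℝ) < armCount A kstar t ω := (mul_pos hM0 hlog).trans_le hcon.2
  refine notMem_candidates hcon.1 hk ?_ ?_ (hQ π hrun.policy t _ k (hA ▸ hω t))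
  · rw [pulls_history]
    exact_mod_cast hn.ne'
  · rw [width, pulls_history]
    refine Real.sqrt_le_iff.2 ⟨by positivity, ?_⟩
    rw [div_le_iff₀ hn]
    calc 2 * α * σ ^ 2 * Real.log t = (ε / 2) ^ 2 * (M * Real.log t) := by
          rw [hMdef]
          field_simp
          ring
      _ ≤ _ := mul_le_mul_of_nonneg_left hcon.2 (by positivity)

end SummablyRare

/-! ### From the number of pulls to the regret -/

section Regret

universe u

variable {K : ℕ} {Θ : Type*} {μ : Fin K → Θ → ℝ} {θstar : Θ} {kstar : Fin K} {σ : ℝ≥0}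

lemma expRegret_eq_sum {Ω : Type*} [MeasurableSpace Ω] {P : Measure Ω} [IsProbabilityMeasure P]
    {A : ℕ → Ω → Fin K} (hA : ∀ t, Measurable (A t)) (T : ℕ) :
    expRegret μ kstar θstar P A T = ∑ k, (μ kstar θstar - μ k θstar) *
      ∑ t ∈ Finset.range T, P.real {ω | A t ω = k} := by
  have hm : ∀ t k, MeasurableSet {ω | A t ω = k} := fun t k => hA t (measurableSet_singleton k)
  have h1 : ∀ t ω, μ kstar θstar - μ (A t ω) θstar =
      ∑ k, {ω | A t ω = k}.indicator (fun _ => μ kstar θstar - μ k θstar) ω := by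
    intro t ω
    simp [Set.indicator_apply]
  have hint : ∀ t k, Integrable
      ({ω | A t ω = k}.indicator fun _ => μ kstar θstar - μ k θstar) P := fun t k =>
    (integrable_const _).indicator (hm t k)
  unfold expRegret
  simp_rw [h1]
  rw [integral_finsetSum _ fun t _ => integrable_finsetSum _ fun k _ => hint t k]
  simp_rw [Finset.mul_sum]
  rw [Finset.sum_comm]
  refine Finset.sum_congr rfl fun t _ => ?_
  rw [integral_finsetSum _ fun k _ => hint t k]
  refine Finset.sum_congr rfl fun k _ => ?_
  rw [integral_indicator_const _ (hm t k), smul_eq_mul, mul_comm]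

lemma sum_measureReal_pull_le {Ω : Type*} [MeasurableSpace Ω] {P : Measure Ω}
    [IsProbabilityMeasure P] {A : ℕ → Ω → Fin K} (hA : ∀ t, Measurable (A t)) (k : Fin K)
    {x : ℝ} (hx : 0 ≤ x) (T : ℕ) :
    ∑ t ∈ Finset.range T, P.real {ω | A t ω = k ∧ (armCount A k t ω : ℝ) < x} ≤ x + 1 := by
  have hn : ∀ t, Measurable (armCount A k t) := fun t =>
    Finset.measurable_fun_sum _ fun i _ =>
      Measurable.ite (hA i (measurableSet_singleton k)) measurable_const measurable_const
  have hm : ∀ t, MeasurableSet {ω | A t ω = k ∧ (armCount A k t ω : ℝ) < x} := fun t =>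
    (hA t (measurableSet_singleton k)).inter
      (hn t (MeasurableSet.of_discrete (s := {n : ℕ | (n : ℝ) < x})))
  calc _ = ∫ ω, ∑ t ∈ Finset.range T,
        {ω | A t ω = k ∧ (armCount A k t ω : ℝ) < x}.indicator (fun _ => (1 : ℝ)) ω ∂P := by
        rw [integral_finsetSum _ fun t _ => (integrable_const _).indicator (hm t)]
        refine Finset.sum_congr rfl fun t _ => ?_
        rw [integral_indicator_const _ (hm t), smul_eq_mul, mul_one]
    _ ≤ ∫ ω, x + 1 ∂P := by
        refine integral_mono (integrable_finsetSum _ fun t _ =>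
          (integrable_const _).indicator (hm t)) (integrable_const _) fun ω => ?_
        refine le_trans (le_of_eq (Finset.sum_congr rfl fun t _ => ?_))
          (sum_pulls_lt_le (A := A) (k := k) (ω := ω) hx T)
        simp [Set.indicator_apply]
    _ = _ := by simp

/-- The optimal arm is competitive and has gap zero, which leaves one competitive arm fewer to pay
for. A suboptimal competitive arm has at most `L log T + 1` pulls while its count is below `L log
T`; its other pulls are summably rare. -/
lemma expRegret_le_of_pulls (hopt : ∀ k, μ k θstar ≤ μ kstar θstar)
    {Ω : Type*} [MeasurableSpace Ω] {P : Measure Ω} [IsProbabilityMeasure P]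
    {A : ℕ → Ω → Fin K} (hA : ∀ t, Measurable (A t)) {f : ℕ → ℝ} (hf : Summable f)
    (hf0 : ∀ t, 0 ≤ f t) {L : ℝ} (hL : 0 ≤ L)
    (hnc : ∀ k, ¬ Competitive μ kstar θstar k → ∀ t, P.real {ω | A t ω = k} ≤ f t)
    (hc : ∀ k, μ k θstar < μ kstar θstar → ∀ t,
      P.real {ω | A t ω = k ∧ L * Real.log t ≤ armCount A k t ω} ≤ f t) (T : ℕ) :
    expRegret μ kstar θstar P A T ≤
      ((numCompetitive μ kstar θstar : ℝ) - 1) *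
        ((∑ k, (μ kstar θstar - μ k θstar)) * (L * Real.log T + 1 + ∑' t, f t)) +
      ((K : ℝ) - (numCompetitive μ kstar θstar : ℝ)) *
        ((∑ k, (μ kstar θstar - μ k θstar)) * ∑' t, f t) := by
  classical
  set D := ∑ k, (μ kstar θstar - μ k θstar) with hD
  set F := ∑' t, f t with hF
  have hgap : ∀ k, 0 ≤ μ kstar θstar - μ k θstar := fun k => sub_nonneg.2 (hopt k)
  have hgapD : ∀ k, μ kstar θstar - μ k θstar ≤ D := fun k =>
    Finset.single_le_sum (fun j _ => hgap j) (Finset.mem_univ k)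
  have hD0 : 0 ≤ D := Finset.sum_nonneg fun k _ => hgap k
  have hF0 : 0 ≤ F := tsum_nonneg hf0
  have hfF : ∑ t ∈ Finset.range T, f t ≤ F := hf.sum_le_tsum _ fun t _ => hf0 t
  have hlogT : 0 ≤ Real.log T := Real.log_natCast_nonneg T
  set X := D * (L * Real.log T + 1 + F) with hX
  have hX0 : 0 ≤ X := by positivity
  set S : Finset (Fin K) := Finset.univ.filter fun k => Competitive μ kstar θstar k with hS
  have hScard : (S.card : ℝ) = numCompetitive μ kstar θstar := by
    rw [numCompetitive, ← Set.ncard_coe_finset]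
    congr 2
    ext k
    simp [hS]
  have hstar : kstar ∈ S := by simpa [hS] using competitive_optimal hopt
  have hterm : ∀ k ∈ S.erase kstar, (μ kstar θstar - μ k θstar) *
      ∑ t ∈ Finset.range T, P.real {ω | A t ω = k} ≤ X := by
    intro k _
    rcases (hopt k).eq_or_lt with heq | hlt
    · rw [heq, sub_self, zero_mul]
      exact hX0
    · refine mul_le_mul (hgapD k) ?_ (Finset.sum_nonneg fun t _ => measureReal_nonneg) hD0
      calc _ ≤ ∑ t ∈ Finset.range T,
            (P.real {ω | A t ω = k ∧ (armCount A k t ω : ℝ) < L * Real.log T} + f t) := by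
            refine Finset.sum_le_sum fun t ht => ?_
            refine le_trans (measureReal_mono (s₂ := {ω | A t ω = k ∧
              (armCount A k t ω : ℝ) < L * Real.log T} ∪
              {ω | A t ω = k ∧ L * Real.log t ≤ armCount A k t ω}) (fun ω hω => ?_)
              (measure_ne_top _ _)) ((measureReal_union_le _ _).trans
                (add_le_add_right (hc k hlt t) _))
            -- Counting needs the fixed threshold `L log T`, while rarity is known above `L log t`,
            -- which is smaller since `t < T`.
            rcases lt_or_ge (armCount A k t ω : ℝ) (L * Real.log T) with h | h
            · exact Or.inl ⟨hω, h⟩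
            · refine Or.inr ⟨hω, le_trans (mul_le_mul_of_nonneg_left ?_ hL) h⟩
              rcases Nat.eq_zero_or_pos t with rfl | h0
              · simpa using hlogT
              · exact Real.log_le_log (by exact_mod_cast h0)
                  (by exact_mod_cast (Finset.mem_range.1 ht).le)
        _ ≤ _ := by
            rw [Finset.sum_add_distrib]
            exact add_le_add (sum_measureReal_pull_le hA k (mul_nonneg hL hlogT) T) hfF
  have hterm' : ∀ k ∈ Sᶜ, (μ kstar θstar - μ k θstar) *
      ∑ t ∈ Finset.range T, P.real {ω | A t ω = k} ≤ D * F := by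
    intro k hk
    have hk : ¬ Competitive μ kstar θstar k := by simpa [hS] using hk
    exact mul_le_mul (hgapD k) ((Finset.sum_le_sum fun t _ => hnc k hk t).trans hfF)
      (Finset.sum_nonneg fun t _ => measureReal_nonneg) hD0
  rw [expRegret_eq_sum hA, ← Finset.sum_add_sum_compl S, ← Finset.add_sum_erase S _ hstar,
    sub_self, zero_mul, zero_add]
  refine add_le_add ((Finset.sum_le_card_nsmul _ _ _ hterm).trans (le_of_eq ?_))
    ((Finset.sum_le_card_nsmul _ _ _ hterm').trans (le_of_eq ?_))
  · rw [nsmul_eq_mul, Finset.card_erase_of_mem hstar,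
      Nat.cast_sub (Finset.card_pos.2 ⟨_, hstar⟩), hScard, Nat.cast_one]
  · rw [nsmul_eq_mul, Finset.card_compl, Nat.cast_sub (Finset.card_le_univ S), hScard,
      Fintype.card_fin]

/-- The regret bound for a class of policies that choose among the candidates, pull the optimal arm
sufficiently often, and rarely pull a suboptimal arm with a logarithmic number of pulls. -/
lemma exists_expRegret_le (hopt : ∀ k, μ k θstar ≤ μ kstar θstar) (hσ : 0 < σ) {α : ℝ}
    (hα : 2 < α) {Q : Policy K → Prop}
    (hQ : ∀ π, Q π → ∀ t (h : History K t) k, π t h {k} ≠ 0 → k ∈ candidates μ α σ h)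
    (hM : ∀ M : ℝ, 0 < M → SummablyRare.{u} μ θstar σ Q
      fun _ _ A _ t => {ω | (armCount A kstar t ω : ℝ) < M * Real.log t})
    (hc : ∀ k, μ k θstar < μ kstar θstar → ∃ L : ℝ, 0 ≤ L ∧ SummablyRare.{u} μ θstar σ Q
      fun _ _ A _ t => {ω | A t ω = k ∧ L * Real.log t ≤ armCount A k t ω}) :
    ∃ c₁ c₂ : ℝ, 0 ≤ c₁ ∧ 0 ≤ c₂ ∧
      ∀ (ν : Kernel (Fin K) ℝ) [IsMarkovKernel ν], IsRewardLaw μ θstar σ ν →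
      ∀ (π : Policy K) [∀ t, IsMarkovKernel (π t)], Q π →
      ∀ {Ω : Type u} [MeasurableSpace Ω] (P : Measure Ω) [IsProbabilityMeasure P]
        (A : ℕ → Ω → Fin K) (R : ℕ → Ω → ℝ), IsRun π ν P A R →
        (∀ T : ℕ, 2 ≤ T → expRegret μ kstar θstar P A T ≤
          ((numCompetitive μ kstar θstar : ℝ) - 1) * (c₁ * Real.log T) +
          ((K : ℝ) - (numCompetitive μ kstar θstar : ℝ)) * c₂) ∧
        (numCompetitive μ kstar θstar = 1 →
          ∀ T : ℕ, expRegret μ kstar θstar P A T ≤ ((K : ℝ) - 1) * c₂) := by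
  have hnc : ∀ k : {k // ¬ Competitive μ kstar θstar k}, SummablyRare.{u} μ θstar σ Q
      fun _ _ A _ t => {ω | A t ω = k.1} := fun k =>
    summablyRare_of_not_competitive hσ hα hQ hM k.2
  have hc' : ∀ k : {k // μ k θstar < μ kstar θstar}, ∃ L : ℝ, 0 ≤ L ∧
      SummablyRare.{u} μ θstar σ Q
        fun _ _ A _ t => {ω | A t ω = k.1 ∧ L * Real.log t ≤ armCount A k.1 t ω} := fun k =>
    hc k.1 k.2
  choose g hg hg0 hgE using hnc
  choose L' hL' f hf hf0 hfE using hc'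
  classical
  set F : ℕ → ℝ := fun t => ∑ k, g k t + ∑ k, f k t with hFdef
  have hF : Summable F := (summable_sum fun k _ => hg k).add (summable_sum fun k _ => hf k)
  have hgs : ∀ t, 0 ≤ ∑ k, g k t := fun t => Finset.sum_nonneg fun k _ => hg0 k t
  have hfs : ∀ t, 0 ≤ ∑ k, f k t := fun t => Finset.sum_nonneg fun k _ => hf0 k t
  have hF0 : ∀ t, 0 ≤ F t := fun t => add_nonneg (hgs t) (hfs t)
  -- The sum of the nonnegative thresholds serves all suboptimal arms at once.
  set L : ℝ := ∑ k, L' k with hLdef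
  have hL : 0 ≤ L := Finset.sum_nonneg fun k _ => hL' k
  set D := ∑ k, (μ kstar θstar - μ k θstar) with hD
  have hD0 : 0 ≤ D := Finset.sum_nonneg fun k _ => sub_nonneg.2 (hopt k)
  set S := ∑' t, F t with hSdef
  have hS0 : 0 ≤ S := tsum_nonneg hF0
  have hlog2 : 0 < Real.log 2 := Real.log_pos (by norm_num)
  have hC : (1 : ℝ) ≤ numCompetitive μ kstar θstar := by
    have : 0 < numCompetitive μ kstar θstar :=
      (Set.ncard_pos (Set.toFinite _)).2 ⟨kstar, competitive_optimal hopt⟩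
    exact_mod_cast this
  -- For `T ≥ 2` the additive constant `1 + S` is absorbed into `(1 + S) / log 2 * log T`.
  refine ⟨D * (L + (1 + S) / Real.log 2), D * S, by positivity, by positivity, ?_⟩
  intro ν _ hν π _ hπ Ω _ P _ A R hrun
  have hb : IsBanditRun μ θstar σ Q π ν P A R := ⟨‹_›, hν, ‹_›, hπ, ‹_›, hrun⟩
  have key := expRegret_le_of_pulls hopt hrun.measurable_arm hF hF0 hL (P := P)
    (fun k hk t => by
      refine (hgE ⟨k, hk⟩ Ω π ν P A R hb t).trans ?_
      exact (Finset.single_le_sum (fun j _ => hg0 j t) (Finset.mem_univ _)).trans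
        (le_add_of_nonneg_right (hfs t)))
    (fun k hk t => by
      refine le_trans (measureReal_mono ?_ (measure_ne_top _ _))
        ((hfE ⟨k, hk⟩ Ω π ν P A R hb t).trans ((Finset.single_le_sum (fun j _ => hf0 j t)
          (Finset.mem_univ _)).trans (le_add_of_nonneg_left (hgs t))))
      rintro ω ⟨h1, h2⟩
      refine ⟨h1, le_trans ?_ h2⟩
      exact mul_le_mul_of_nonneg_right (Finset.single_le_sum (fun j _ => hL' j)
        (Finset.mem_univ (⟨k, hk⟩ : {k // μ k θstar < μ kstar θstar})))
        (Real.log_natCast_nonneg t))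
  refine ⟨fun T hT => (key T).trans ?_, fun h1 T => (key T).trans (le_of_eq ?_)⟩
  · refine add_le_add (mul_le_mul_of_nonneg_left ?_ (by linarith)) le_rfl
    have hlogT : Real.log 2 ≤ Real.log T :=
      Real.log_le_log (by norm_num) (by exact_mod_cast hT)
    have h2 : 1 + S ≤ (1 + S) / Real.log 2 * Real.log T := by
      rw [div_mul_eq_mul_div, le_div_iff₀ hlog2]
      exact mul_le_mul_of_nonneg_left hlogT (by positivity)
    rw [mul_assoc]
    refine mul_le_mul_of_nonneg_left ?_ hD0
    rw [add_mul]
    linarith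
  · rw [h1, Nat.cast_one, sub_self, zero_mul, zero_add]

end Regret

/-! ### Arms that are pulled in a constant fraction of the rounds -/

/-- Pigeonhole. The factor `2` leaves `t / (2 * K)` pulls of `l` after its first `t / (2 * K)`
pulls. -/
lemma exists_armCount_ge {Ω : Type*} {K : ℕ} (hK : 0 < K) (A : ℕ → Ω → Fin K) (t : ℕ) (ω : Ω) :
    ∃ l, 2 * (t / (2 * K)) ≤ armCount A l t ω := by
  by_contra! hcon
  have : Nonempty (Fin K) := ⟨⟨0, hK⟩⟩
  have h1 := Finset.sum_lt_sum_of_nonempty Finset.univ_nonempty fun l _ => hcon l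
  rw [sum_armCount, Finset.sum_const, Finset.card_univ, Fintype.card_fin, smul_eq_mul] at h1
  have h2 := Nat.div_mul_le_self t (2 * K)
  nlinarith

lemma eventually_mul_log_sq_le (C : ℝ) {c : ℝ} (hc : 0 < c) :
    ∀ᶠ t : ℕ in atTop, C * Real.log t ^ 2 ≤ c * t := by
  have h1 := (Real.isLittleO_pow_log_id_atTop (n := 2)).comp_tendsto tendsto_natCast_atTop_atTop
  have hd : 0 < c / (|C| + 1) := by positivity
  filter_upwards [h1.def hd] with t ht
  simp only [Function.comp_apply, id, Real.norm_eq_abs, abs_pow, sq_abs, Nat.abs_cast] at ht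
  have h3 : C * Real.log t ^ 2 ≤ (|C| + 1) * Real.log t ^ 2 :=
    mul_le_mul_of_nonneg_right (by linarith [le_abs_self C]) (sq_nonneg _)
  refine h3.trans ((mul_le_mul_of_nonneg_left ht (by positivity)).trans (le_of_eq ?_))
  field_simp

lemma eventually_le_log (C : ℝ) : ∀ᶠ t : ℕ in atTop, C ≤ Real.log t :=
  (Real.tendsto_log_atTop.comp tendsto_natCast_atTop_atTop).eventually_ge_atTop C

lemma eventually_mul_log_lt (C : ℝ) {c : ℝ} (hc : 0 < c) :
    ∀ᶠ t : ℕ in atTop, C * Real.log t < c * t := by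
  filter_upwards [eventually_mul_log_sq_le (|C| + 1) hc, eventually_le_log 1] with t h1 h2
  refine lt_of_lt_of_le ?_ h1
  have h3 : Real.log t ≤ Real.log t ^ 2 := by nlinarith
  have h4 : C * Real.log t ≤ |C| * Real.log t :=
    mul_le_mul_of_nonneg_right (le_abs_self C) (by linarith)
  have h5 : |C| * Real.log t ≤ |C| * Real.log t ^ 2 :=
    mul_le_mul_of_nonneg_left h3 (abs_nonneg C)
  linarith

/-- With `α > 3` the confidence level in rounds `i ≥ c * t` is at least `27 / 10 * log t`. This
exceeds the level `5 / 2 * log t` of the deviation event, which in turn is above the threshold `2`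
for summability. -/
lemma eventually_log_le_log {c : ℝ} (hc : 0 < c) :
    ∀ᶠ t : ℕ in atTop, ∀ x : ℝ, c * t ≤ x → 9 / 10 * Real.log t ≤ Real.log x := by
  filter_upwards [eventually_le_log (-(10 * Real.log c)), eventually_ge_atTop 1] with t h1 h2 x hx
  have ht : (0 : ℝ) < t := by exact_mod_cast h2
  have h3 := Real.log_le_log (mul_pos hc ht) hx
  rw [Real.log_mul hc.ne' ht.ne'] at h3
  linarith

lemma eventually_le_div {K : ℕ} (hK : 0 < K) :
    ∀ᶠ t : ℕ in atTop, (4 * K : ℝ)⁻¹ * t ≤ (t / (2 * K) : ℕ) := by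
  filter_upwards [eventually_ge_atTop (4 * K)] with t ht
  have hK' : (0 : ℝ) < K := by exact_mod_cast hK
  have h1 : t < 2 * K * (t / (2 * K) + 1) := Nat.lt_mul_div_succ t (by omega)
  have h2 : t ≤ 4 * K * (t / (2 * K)) := by
    have : 1 ≤ t / (2 * K) := (Nat.one_le_div_iff (by omega)).2 (by omega)
    nlinarith
  rw [inv_mul_le_iff₀ (by positivity)]
  exact_mod_cast h2

section Deviation

variable {Ω : Type*} {K : ℕ} {Θ : Type*} {μ : Fin K → Θ → ℝ} {θstar : Θ} {kstar : Fin K}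
  {α : ℝ} {β σ : ℝ≥0} {A : ℕ → Ω → Fin K} {R : ℕ → Ω → ℝ} {ω : Ω} {t : ℕ}

/-- If the empirical means deviate at most by the width of level `5 / 2` at horizon `t`, then the
true parameter belongs to the confidence sets of all rounds in a constant fraction of `t`. -/
lemma mem_confSet_of_deviation (hα : 3 < α)
    (hdev : ∀ k, ∀ i ≤ t, armCount A k i ω ≠ 0 → |empMean (history A R i ω) k - μ k θstar| <
      Real.sqrt (2 * (5 / 2 * Real.log t) * (σ : ℝ) ^ 2 / armCount A k i ω))
    {i : ℕ} (hi : i ≤ t) (hlog : 9 / 10 * Real.log t ≤ Real.log i) :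
    θstar ∈ confSet μ α σ (history A R i ω) := by
  rw [mem_confSet_history]
  intro k hk
  rw [abs_sub_comm]
  refine (hdev k i hi hk).trans_le (Real.sqrt_le_sqrt ?_)
  refine div_le_div_of_nonneg_right ?_ (Nat.cast_nonneg _)
  have h0 := Real.log_natCast_nonneg t
  have h1 : 5 / 2 * Real.log t ≤ α * Real.log i := by nlinarith
  nlinarith [mul_le_mul_of_nonneg_right h1 (sq_nonneg (σ : ℝ))]

end Deviation

/-! ### UCB-C -/

section UCB

universe u

variable {K : ℕ} {Θ : Type*} {μ : Fin K → Θ → ℝ} {θstar : Θ} {kstar : Fin K} {α : ℝ} {σ : ℝ≥0}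

lemma IsUCBC.index_le {π : Policy K} (hπ : IsUCBC μ α σ π)
    (hopt : ∀ k, μ k θstar ≤ μ kstar θstar) {t : ℕ} {h : History K t}
    (hθ : θstar ∈ confSet μ α σ h) {l : Fin K} (hl : π t h {l} ≠ 0) (hn : pulls h l ≠ 0) :
    pulls h kstar ≠ 0 ∧
      empMean h kstar + width α σ h kstar ≤ empMean h l + width α σ h l := by
  have h1 := (hπ t h l hl).2 kstar (optimal_mem_candidates hopt hθ)
  have h2 : pulls h kstar ≠ 0 := by
    intro h0
    rw [ucbIndex, ucbIndex, if_pos h0, if_neg hn, top_le_iff] at h1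
    exact EReal.coe_ne_top _ h1
  rw [ucbIndex, ucbIndex, if_neg h2, if_neg hn] at h1
  exact ⟨h2, by exact_mod_cast h1⟩

/-- UCB-C rarely pulls the optimal arm less than logarithmically often. -/
lemma summablyRare_starved_ucb (hopt : ∀ k, μ k θstar ≤ μ kstar θstar) (hσ : 0 < σ)
    (hα : 3 < α) (M : ℝ) :
    SummablyRare.{u} μ θstar σ (IsUCBC μ α σ)
      fun _ _ A _ t => {ω | (armCount A kstar t ω : ℝ) < M * Real.log t} := by
  have hK : 0 < K := kstar.pos
  have hK' : (0 : ℝ) < K := by exact_mod_cast hK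
  have hσ' : (0 : ℝ) < σ := hσ
  set c : ℝ := (4 * K : ℝ)⁻¹ with hc
  have hc0 : 0 < c := by positivity
  -- In units of `√(σ² log t / n)`, the width of `kstar` is at least `√(2 * 27 / 10)` and its
  -- deviation at most `√(2 * 5 / 2)`, so its index exceeds its mean by `κ` units. The index of `l`
  -- exceeds its mean by at most `b` units.
  set κ : ℝ := Real.sqrt (27 / 5) - Real.sqrt 5 with hκ
  have hκ0 : 0 < κ := sub_pos.2 (Real.sqrt_lt_sqrt (by norm_num) (by norm_num))
  set b : ℝ := Real.sqrt 5 + Real.sqrt (2 * α) with hb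
  have hb0 : 0 ≤ b := by positivity
  refine (summablyRare_deviation hσ (a := 5 / 2) (by norm_num)).mono ?_
  filter_upwards [eventually_ge_atTop 2, eventually_le_div hK, eventually_log_le_log hc0,
    eventually_mul_log_lt M hc0, eventually_mul_log_lt (b ^ 2 * M) (mul_pos (sq_pos_of_pos hκ0) hc0)]
    with t ht hN hlog hMt hbt Ω _ π ν P A R hrun
  have := hrun.prob
  have := hrun.markov_policy
  filter_upwards [hrun.run.ae_apply_ne_zero] with ω hω (hstarved : (armCount A kstar t ω : ℝ) < M * Real.log t)
  by_contra hcon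
  simp only [not_exists, not_and, not_le] at hcon
  have ht0 : (0 : ℝ) < t := by positivity
  have hlogt : 0 < Real.log t := Real.log_pos (by exact_mod_cast ht)
  set N := t / (2 * K) with hNdef
  have hN0 : (0 : ℝ) < N := (mul_pos hc0 ht0).trans_le hN
  obtain ⟨l, hl⟩ := exists_armCount_ge hK A t ω
  -- One round in which `l` is pulled with `N` pulls already made suffices for the contradiction.
  -- Such a round has index at least `N`.
  have hpos : 0 < ∑ i ∈ Finset.range t, if A i ω = l ∧ N ≤ armCount A l i ω then 1 else 0 := by
    rw [sum_pulls_ge]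
    have : 0 < N := by exact_mod_cast hN0
    omega
  obtain ⟨i, hi, hif⟩ := Finset.exists_ne_zero_of_sum_ne_zero hpos.ne'
  have hit : i < t := Finset.mem_range.1 hi
  obtain ⟨hAi, hNi⟩ : A i ω = l ∧ N ≤ armCount A l i ω := by
    by_contra h
    exact hif (if_neg h)
  have hNl : (N : ℝ) ≤ armCount A l i ω := by exact_mod_cast hNi
  have hnl : (0 : ℝ) < armCount A l i ω := hN0.trans_le hNl
  have hni : c * t ≤ i :=
    hN.trans (hNl.trans (Nat.cast_le.2 (armCount_le i)))
  have hi0 : (0 : ℝ) < i := (mul_pos hc0 ht0).trans_le hni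
  have hlogi := hlog i hni
  have hlogle : Real.log i ≤ Real.log t := Real.log_le_log hi0 (by exact_mod_cast hit.le)
  have hθ := mem_confSet_of_deviation (μ := μ) (σ := σ) hα (fun k j hj hj0 => hcon k j hj hj0)
    hit.le hlogi
  obtain ⟨hs0, hidx⟩ := hrun.policy.index_le hopt hθ (hAi ▸ hω i)
    (by rw [pulls_history]; exact_mod_cast hnl.ne')
  rw [pulls_history] at hs0
  have hns : (0 : ℝ) < armCount A kstar i ω := by exact_mod_cast Nat.pos_of_ne_zero hs0
  have hnsM : (armCount A kstar i ω : ℝ) < M * Real.log t := by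
    refine lt_of_le_of_lt ?_ hstarved
    exact_mod_cast armCount_mono (A := A) (k := kstar) (ω := ω) hit.le
  have hd1 := abs_lt.1 (hcon kstar i hit.le hs0)
  have hd2 := abs_lt.1 (hcon l i hit.le (by exact_mod_cast hnl.ne'))
  simp only [width, pulls_history] at hidx
  set x := (σ : ℝ) ^ 2 * Real.log t with hx
  have hx0 : 0 < x := by positivity
  set y := Real.sqrt (x / armCount A kstar i ω) with hy
  set z := Real.sqrt (x / armCount A l i ω) with hz
  have e1 : Real.sqrt (2 * (5 / 2 * Real.log t) * (σ : ℝ) ^ 2 / armCount A kstar i ω) =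
      Real.sqrt 5 * y := by
    rw [hy, ← Real.sqrt_mul (by norm_num)]
    congr 1
    rw [hx]
    ring
  have e2 : Real.sqrt (2 * (5 / 2 * Real.log t) * (σ : ℝ) ^ 2 / armCount A l i ω) =
      Real.sqrt 5 * z := by
    rw [hz, ← Real.sqrt_mul (by norm_num)]
    congr 1
    rw [hx]
    ring
  have e3 : Real.sqrt (27 / 5) * y ≤
      Real.sqrt (2 * α * (σ : ℝ) ^ 2 * Real.log i / armCount A kstar i ω) := by
    rw [hy, ← Real.sqrt_mul (by norm_num)]
    refine Real.sqrt_le_sqrt ?_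
    rw [← mul_div_assoc]
    refine div_le_div_of_nonneg_right ?_ hns.le
    calc 27 / 5 * x = 2 * σ ^ 2 * (3 * (9 / 10 * Real.log t)) := by rw [hx]; ring
      _ ≤ 2 * σ ^ 2 * (α * Real.log i) := by gcongr
      _ = _ := by ring
  have e4 : Real.sqrt (2 * α * (σ : ℝ) ^ 2 * Real.log i / armCount A l i ω) ≤
      Real.sqrt (2 * α) * z := by
    rw [hz, ← Real.sqrt_mul (by linarith)]
    refine Real.sqrt_le_sqrt ?_
    rw [← mul_div_assoc]
    refine div_le_div_of_nonneg_right ?_ hnl.le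
    rw [hx, mul_assoc (2 * α)]
    exact mul_le_mul_of_nonneg_left (mul_le_mul_of_nonneg_left hlogle (sq_nonneg _)) (by linarith)
  have hlt : b * z < κ * y := by
    have h1 : b ^ 2 * armCount A kstar i ω < κ ^ 2 * armCount A l i ω := by
      calc b ^ 2 * armCount A kstar i ω ≤ b ^ 2 * (M * Real.log t) :=
            mul_le_mul_of_nonneg_left hnsM.le (sq_nonneg _)
        _ = b ^ 2 * M * Real.log t := by ring
        _ < κ ^ 2 * c * t := hbt
        _ = κ ^ 2 * (c * t) := by ring
        _ ≤ _ := mul_le_mul_of_nonneg_left (hN.trans hNl) (sq_nonneg _)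
    refine lt_of_pow_lt_pow_left₀ 2 (by positivity) ?_
    rw [mul_pow, mul_pow, hy, hz, Real.sq_sqrt (by positivity), Real.sq_sqrt (by positivity),
      ← mul_div_assoc, ← mul_div_assoc, div_lt_div_iff₀ hnl hns]
    calc b ^ 2 * x * armCount A kstar i ω = x * (b ^ 2 * armCount A kstar i ω) := by ring
      _ < x * (κ ^ 2 * armCount A l i ω) := mul_lt_mul_of_pos_left h1 hx0
      _ = _ := by ring
  rw [e1] at hd1
  rw [e2] at hd2
  have hol := hopt l
  rw [hb, hκ, add_mul, sub_mul] at hlt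
  linarith [hd1.1, hd2.2]

/-- UCB-C rarely pulls a suboptimal arm that has been pulled logarithmically often. -/
lemma exists_summablyRare_pull_ucb (hopt : ∀ k, μ k θstar ≤ μ kstar θstar) (hσ : 0 < σ)
    (hα : 3 < α) {k : Fin K} (hk : μ k θstar < μ kstar θstar) :
    ∃ L : ℝ, 0 ≤ L ∧ SummablyRare.{u} μ θstar σ (IsUCBC μ α σ)
      fun _ _ A _ t => {ω | A t ω = k ∧ L * Real.log t ≤ armCount A k t ω} := by
  have hσ' : (0 : ℝ) < σ := hσ
  set Δ := μ kstar θstar - μ k θstar with hΔ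
  have hΔ0 : 0 < Δ := sub_pos.2 hk
  -- With `L log t` pulls the width is `Δ / 2`, so the index of `k` stays below `μ kstar θstar`,
  -- which is below the index of `kstar`.
  set L : ℝ := 8 * α * σ ^ 2 / Δ ^ 2 with hLdef
  have hL0 : 0 < L := by positivity
  refine ⟨L, hL0.le, (summablyRare_notMem_confSet hσ (α := α) (by linarith)).mono ?_⟩
  filter_upwards [eventually_ge_atTop 2] with t ht Ω _ π ν P A R hrun
  have := hrun.prob
  have := hrun.markov_policy
  filter_upwards [hrun.run.ae_apply_ne_zero] with ω hω hpull hθ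
  obtain ⟨hA, hn⟩ := hpull
  have hlog : 0 < Real.log t := Real.log_pos (by exact_mod_cast ht)
  have hn0 : (0 : ℝ) < armCount A k t ω := (mul_pos hL0 hlog).trans_le hn
  have hp : pulls (history A R t ω) k ≠ 0 := by
    rw [pulls_history]
    exact_mod_cast hn0.ne'
  obtain ⟨hs0, hidx⟩ := hrun.policy.index_le hopt hθ (hA ▸ hω t) hp
  have hw : width α σ (history A R t ω) k ≤ Δ / 2 := by
    rw [width, pulls_history]
    refine Real.sqrt_le_iff.2 ⟨by positivity, ?_⟩
    rw [div_le_iff₀ hn0]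
    calc 2 * α * σ ^ 2 * Real.log t = (Δ / 2) ^ 2 * (L * Real.log t) := by
          rw [hLdef]
          field_simp
          ring
      _ ≤ _ := mul_le_mul_of_nonneg_left hn (by positivity)
  have h1 := abs_lt.1 (hθ kstar hs0)
  have h2 := abs_lt.1 (hθ k hp)
  linarith [h1.2, h2.1]

end UCB

/-! ### TS-C -/

/-! ### Gaussian tails on the logarithmic scale. -/

section Gaussian

variable {V : ℝ≥0} {n : ℕ} {L y : ℝ}

lemma coe_variance_pos (hV : 0 < V) (hn : n ≠ 0) : (0 : ℝ) < (V / n : ℝ≥0) := by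
  have : (0 : ℝ≥0) < n := by exact_mod_cast Nat.pos_of_ne_zero hn
  exact_mod_cast div_pos hV this

lemma exp_neg_sq_sqrt (hV : 0 < V) (hn : n ≠ 0) (hL : 0 ≤ L) :
    Real.exp (-Real.sqrt (2 * V * L / n) ^ 2 / (2 * (V / n : ℝ≥0))) = Real.exp (-L) := by
  have hn' : (0 : ℝ) < n := by exact_mod_cast Nat.pos_of_ne_zero hn
  have hV' : (0 : ℝ) < V := hV
  rw [Real.sq_sqrt (by positivity)]
  congr 1
  push_cast
  field_simp

lemma gaussianReal_div_Ici_le (m : ℝ) (hV : 0 < V) (hn : n ≠ 0) (hL : 0 ≤ L)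
    (hy : m + Real.sqrt (2 * V * L / n) ≤ y) :
    (gaussianReal m (V / n)).real (Set.Ici y) ≤ Real.exp (-L) :=
  (gaussianReal_Ici_le m _ (Real.sqrt_nonneg _) hy).trans_eq (exp_neg_sq_sqrt hV hn hL)

lemma gaussianReal_div_Iic_le (m : ℝ) (hV : 0 < V) (hn : n ≠ 0) (hL : 0 ≤ L)
    (hy : y ≤ m - Real.sqrt (2 * V * L / n)) :
    (gaussianReal m (V / n)).real (Set.Iic y) ≤ Real.exp (-L) :=
  (gaussianReal_Iic_le m _ (Real.sqrt_nonneg _) hy).trans_eq (exp_neg_sq_sqrt hV hn hL)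

/-- For `ρ < 1`, a Gaussian tail at `1 + √(2 ρ log t)` standard deviations is of larger order than
`t ^ (-(1 + ρ) / 2)`. -/
lemma eventually_le_gaussian_tail {ρ : ℝ} (hρ0 : 0 < ρ) (hρ : ρ < 1) :
    ∀ᶠ t : ℕ in atTop, 2 * (t : ℝ) ^ (-((1 + ρ) / 2)) ≤ (Real.sqrt (2 * Real.pi))⁻¹ *
      Real.exp (-(1 + Real.sqrt (2 * ρ * Real.log t) + 1) ^ 2 / 2) := by
  set ε : ℝ := (1 - ρ) / 4 with hε
  have hε0 : 0 < ε := by linarith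
  set C : ℝ := Real.log (2 * Real.sqrt (2 * Real.pi)) with hC
  have hpi : 0 < Real.sqrt (2 * Real.pi) := by positivity
  filter_upwards [eventually_le_log ((2 * (1 + 1 / ε) + C) / ε), eventually_ge_atTop 1]
    with t ht ht1
  have ht0 : (0 : ℝ) < t := by exact_mod_cast ht1
  have hlog : 0 ≤ Real.log t := Real.log_natCast_nonneg t
  set s := Real.sqrt (2 * ρ * Real.log t) with hs
  have hs2 : s ^ 2 = 2 * ρ * Real.log t := Real.sq_sqrt (by positivity)
  rw [div_le_iff₀ hε0] at ht
  -- The cross term of `(s + 2) ^ 2` is absorbed by the arithmetic-geometric mean inequality at the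
  -- price of a factor `1 + ε` on `s ^ 2`.
  have h1 : 4 * s ≤ ε * s ^ 2 + 4 / ε := by
    have : ε * s ^ 2 + 4 / ε - 4 * s = (ε * s - 2) ^ 2 / ε := by field_simp; ring
    have h2 : 0 ≤ (ε * s - 2) ^ 2 / ε := by positivity
    linarith
  have h2 : C + (1 + s + 1) ^ 2 / 2 ≤ (1 + ρ) / 2 * Real.log t := by
    have h3 : (1 + s + 1) ^ 2 / 2 ≤ (1 + ε) * (ρ * Real.log t) + 2 * (1 + 1 / ε) := by
      have h4 : 4 / ε = 4 * (1 / ε) := by ring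
      nlinarith
    have h5 : ε * (ρ * Real.log t) ≤ ε * Real.log t :=
      mul_le_mul_of_nonneg_left (mul_le_of_le_one_left hlog hρ.le) hε0.le
    have h6 : Real.log t * ε = Real.log t / 4 - ρ * Real.log t / 4 := by rw [hε]; ring
    linarith
  rw [le_inv_mul_iff₀ hpi, Real.rpow_def_of_pos ht0,
    show Real.sqrt (2 * Real.pi) * (2 * Real.exp (Real.log t * -((1 + ρ) / 2))) =
      2 * Real.sqrt (2 * Real.pi) * Real.exp (Real.log t * -((1 + ρ) / 2)) by ring,
    ← Real.exp_log (show 0 < 2 * Real.sqrt (2 * Real.pi) by positivity), ← Real.exp_add]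
  refine Real.exp_le_exp.2 ?_
  linarith

end Gaussian

/-! ### Rare events for the comparison of Thompson probabilities. -/

section Rare

universe u

variable {K : ℕ} {Θ : Type*} {μ : Fin K → Θ → ℝ} {θstar : Θ} {kstar : Fin K} {σ : ℝ≥0}
  {Q : Policy K → Prop}

/-- Deviations at a level `a > 1` of the empirical mean of an arm during its first
logarithmically many pulls are rare. -/
lemma summablyRare_deviation_initial (hσ : 0 < σ) {a M : ℝ} (ha : 1 < a) (hM : 0 ≤ M)
    (k : Fin K) :
    SummablyRare.{u} μ θstar σ Q fun _ _ A R t => {ω | ∃ i ≤ t, armCount A k i ω ≠ 0 ∧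
      armCount A k i ω ≤ ⌊M * Real.log t⌋₊ ∧
      Real.sqrt (2 * (a * Real.log t) * (σ ^ 2 : ℝ≥0) / armCount A k i ω) ≤
        |empMean (history A R i ω) k - μ k θstar|} := by
  -- The union bound costs only `M log t ≤ M t ^ ε / ε`, and `ε - a < -1` as soon as `a > 1`.
  set ε : ℝ := (a - 1) / 2 with hε
  have hε0 : 0 < ε := by linarith
  refine SummablyRare.of_eventually_le (f := fun t : ℕ => 2 * M / ε * (t : ℝ) ^ (ε - a))
    ((Real.summable_nat_rpow.2 (by linarith)).mul_left _) ?_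
  filter_upwards [eventually_ge_atTop 1] with t ht Ω _ π ν P A R hrun
  have := hrun.prob
  have := hrun.markov_reward
  have ht0 : (0 : ℝ) < t := by exact_mod_cast ht
  have hlog : 0 ≤ Real.log t := Real.log_natCast_nonneg t
  have hx : 0 ≤ a * Real.log t := mul_nonneg (by linarith) hlog
  refine (hrun.run.measureReal_exists_deviation_le (by positivity) (hrun.reward k).2 hx
    ⌊M * Real.log t⌋₊ t).trans ?_
  have h1 : (⌊M * Real.log t⌋₊ : ℝ) ≤ M * ((t : ℝ) ^ ε / ε) :=
    (Nat.floor_le (by positivity)).trans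
      (mul_le_mul_of_nonneg_left (Real.log_le_rpow_div ht0.le hε0) hM)
  have h2 : Real.exp (-(a * Real.log t)) = (t : ℝ) ^ (-a) := by
    rw [Real.rpow_def_of_pos ht0]
    congr 1
    ring
  rw [h2]
  calc _ ≤ 2 * (M * ((t : ℝ) ^ ε / ε)) * (t : ℝ) ^ (-a) := by gcongr
    _ = 2 * M / ε * ((t : ℝ) ^ ε * (t : ℝ) ^ (-a)) := by ring
    _ = _ := by rw [← Real.rpow_add ht0, sub_eq_add_neg]

/-- The rounds in which the probability of pulling `l` is controlled by that of pulling `k`. -/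
def dominatedRounds {Ω : Type*} (π : Policy K) (A : ℕ → Ω → Fin K) (R : ℕ → Ω → ℝ) (k l : Fin K)
    (q η : ℝ≥0) (i : ℕ) : Set Ω :=
  {ω | q * π i (history A R i ω) {l} ≤ η + 2⁻¹ * π i (history A R i ω) {k}}

lemma measurableSet_dominatedRounds {Ω : Type*} (π : Policy K) (A : ℕ → Ω → Fin K)
    (R : ℕ → Ω → ℝ) (k l : Fin K) (q η : ℝ≥0) (i : ℕ) :
    MeasurableSet[past A R i] (dominatedRounds π A R k l q η i) := by
  have hm : ∀ j, Measurable fun h : History K i => π i h {j} := fun j =>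
    (π i).measurable_coe (measurableSet_singleton j)
  exact comap_measurable (history A R i)
    (measurableSet_le ((hm l).const_mul (q : ℝ≥0∞)) (((hm k).const_mul 2⁻¹).const_add (η : ℝ≥0∞)))

/-- Bounds the denominator `(1 + q) ^ N` of the potential estimate below by `exp (N * q / 2)`. -/
lemma exp_half_le_one_add {q : ℝ} (hq0 : 0 ≤ q) (hq1 : q ≤ 1) : Real.exp (q / 2) ≤ 1 + q := by
  have h1 : 1 - q / 2 ≤ Real.exp (-(q / 2)) := by linarith [Real.add_one_le_exp (-(q / 2))]
  have h2 : Real.exp (q / 2) * Real.exp (-(q / 2)) = 1 := by rw [← Real.exp_add]; simp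
  have h3 := Real.exp_pos (q / 2)
  nlinarith [mul_le_mul_of_nonneg_left h1 h3.le]

open Classical in
/-- It is rare that an arm is pulled in a constant fraction of the rounds while the optimal arm,
whose conditional probability is not much smaller, is pulled logarithmically often. -/
lemma summablyRare_dominated {l k : Fin K} (hne : l ≠ k) {M ρ : ℝ} (hM : 0 ≤ M) (hρ0 : 0 ≤ ρ)
    (hρ : ρ < 1) :
    SummablyRare.{u} μ θstar σ Q fun _ π A R t => {ω |
      t / (2 * K) ≤ (∑ i ∈ Finset.range t,
        if A i ω = l ∧ ω ∈ dominatedRounds π A R k l ((t : ℝ≥0) ^ (-ρ)) (t : ℝ≥0)⁻¹ i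
          then 1 else 0) ∧
      armCount A k t ω ≤ ⌊M * Real.log t⌋₊} := by
  have hK : 0 < K := k.pos
  have hK' : (0 : ℝ) < K := by exact_mod_cast hK
  set c : ℝ := (4 * K : ℝ)⁻¹ with hc
  have hc0 : 0 < c := by positivity
  refine SummablyRare.of_eventually_le
    (f := fun t : ℕ => Real.exp 1 * (t : ℝ) ^ (-2 : ℝ))
    ((Real.summable_nat_rpow.2 (by norm_num)).mul_left _) ?_
  -- The constant makes `(M + 2) log t ≤ c * t ^ (1 - ρ) / 2 ≤ N * q / 2`. Thus `(1 + q) ^ N` beats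
  -- the factor `2 ^ J ≤ t ^ M` by `t ^ 2`.
  have hlittle := ((isLittleO_log_rpow_atTop (sub_pos.2 hρ)).comp_tendsto
    tendsto_natCast_atTop_atTop).def (c := c / (2 * (M + 2))) (by positivity)
  filter_upwards [eventually_ge_atTop 1, eventually_le_div hK, hlittle]
    with t ht hN hlog Ω _ π ν P A R hrun
  have := hrun.prob
  have := hrun.markov_policy
  have ht0 : (0 : ℝ) < t := by exact_mod_cast ht
  have hlogt : 0 ≤ Real.log t := Real.log_natCast_nonneg t
  refine (hrun.run.measureReal_rare_le hne
    (measurableSet_dominatedRounds π A R k l ((t : ℝ≥0) ^ (-ρ)) (t : ℝ≥0)⁻¹) t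
    ⌊M * Real.log t⌋₊ (t / (2 * K)) fun i _ ω hω => hω).trans ?_
  set N := t / (2 * K)
  simp only [Function.comp_apply, Real.norm_eq_abs, abs_of_nonneg hlogt,
    abs_of_nonneg (Real.rpow_nonneg ht0.le _)] at hlog
  push_cast
  set q : ℝ := (t : ℝ) ^ (-ρ) with hq
  have hq0 : 0 ≤ q := Real.rpow_nonneg ht0.le _
  have hq1 : q ≤ 1 := Real.rpow_le_one_of_one_le_of_nonpos (by exact_mod_cast ht) (by linarith)
  have h1 : (1 + (t : ℝ)⁻¹) ^ t ≤ Real.exp 1 := by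
    calc (1 + (t : ℝ)⁻¹) ^ t ≤ Real.exp ((t : ℝ)⁻¹) ^ t := by
          gcongr
          linarith [Real.add_one_le_exp ((t : ℝ)⁻¹)]
      _ = Real.exp 1 := by rw [← Real.exp_nat_mul, mul_inv_cancel₀ ht0.ne']
  have h2 : (2 : ℝ) ^ ⌊M * Real.log t⌋₊ ≤ Real.exp (M * Real.log t) := by
    calc (2 : ℝ) ^ ⌊M * Real.log t⌋₊ ≤ Real.exp 1 ^ ⌊M * Real.log t⌋₊ := by
          gcongr
          linarith [Real.add_one_le_exp (1 : ℝ)]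
      _ = Real.exp (⌊M * Real.log t⌋₊ : ℝ) := by rw [← Real.exp_nat_mul, mul_one]
      _ ≤ _ := Real.exp_le_exp.2 (Nat.floor_le (by positivity))
  have h3 : Real.exp ((M + 2) * Real.log t) ≤ (1 + q) ^ N := by
    calc Real.exp ((M + 2) * Real.log t) ≤ Real.exp (N * (q / 2)) := by
          refine Real.exp_le_exp.2 ?_
          calc (M + 2) * Real.log t ≤ (M + 2) * (c / (2 * (M + 2)) * (t : ℝ) ^ (1 - ρ)) := by
                gcongr
            _ = c * (t : ℝ) ^ (1 - ρ) / 2 := by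
                field_simp
            _ = (c * t) * (q / 2) := by
                rw [sub_eq_add_neg, Real.rpow_add ht0, Real.rpow_one, hq]
                ring
            _ ≤ N * (q / 2) := by gcongr
      _ = Real.exp (q / 2) ^ N := by rw [← Real.exp_nat_mul]
      _ ≤ (1 + q) ^ N := by
          gcongr
          exact exp_half_le_one_add hq0 hq1
  calc _ ≤ Real.exp 1 * Real.exp (M * Real.log t) / Real.exp ((M + 2) * Real.log t) := by
        gcongr
    _ = Real.exp 1 * (t : ℝ) ^ (-2 : ℝ) := by
        rw [mul_div_assoc, ← Real.exp_sub, Real.rpow_def_of_pos ht0]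
        congr 2
        ring

end Rare

/-! ### Pulls of the optimal and the suboptimal arms under TS-C. -/

section TS

universe u

variable {K : ℕ} {Θ : Type*} {μ : Fin K → Θ → ℝ} {θstar : Θ} {kstar : Fin K} {α : ℝ}
  {β σ : ℝ≥0}

/-- If the empirical means are accurate, a saturated arm `l` is pulled with a probability
controlled by that of the optimal arm. -/
lemma IsTSC.dominated {π : Policy K} [∀ t, IsMarkovKernel (π t)] (hπ : IsTSC μ α β σ π)
    (hopt : ∀ k, μ k θstar ≤ μ kstar θstar) (hσ : 0 < σ) (hβ : 0 < β) {i : ℕ}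
    {h : History K i} (hθ : θstar ∈ confSet μ α σ h) {l : Fin K} {L a q η : ℝ} {N : ℕ}
    (hN0 : N ≠ 0) (hN : N ≤ pulls h l) (hL : 0 ≤ L) (ha : 0 ≤ a)
    (hl : |empMean h l - μ l θstar| < Real.sqrt (2 * (5 / 2 * L) * (σ : ℝ) ^ 2 / pulls h l))
    (hs : pulls h kstar ≠ 0 → |empMean h kstar - μ kstar θstar| <
      Real.sqrt (2 * (a * L) * (σ : ℝ) ^ 2 / pulls h kstar))
    (hrare : (Real.sqrt 5 + Real.sqrt (2 * β)) ^ 2 * L * pulls h kstar ≤ β * N)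
    (hq : 2 * q ≤ (Real.sqrt (2 * Real.pi))⁻¹ *
      Real.exp (-(1 + Real.sqrt (2 * (a / β) * L) + 1) ^ 2 / 2))
    (hη : Real.exp (-L) ≤ η) :
    q * (π i h).real {l} ≤ η + 2⁻¹ * (π i h).real {kstar} := by
  have hstar := optimal_mem_candidates hopt hθ
  have hη0 : 0 ≤ η := (Real.exp_nonneg _).trans hη
  have hnl : pulls h l ≠ 0 := by omega
  by_cases h0 : pulls h kstar = 0
  · rw [measureReal_def, hπ.apply_eq_zero hnl hstar h0, ENNReal.toReal_zero, mul_zero]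
    positivity
  have hs := hs h0
  have hV : 0 < β * σ ^ 2 := by positivity
  have hσ' : (0 : ℝ) < σ := hσ
  have hβ' : (0 : ℝ) < β := hβ
  have hN' : (0 : ℝ) < N := by exact_mod_cast Nat.pos_of_ne_zero hN0
  have hNl : (N : ℝ) ≤ pulls h l := by exact_mod_cast hN
  have hn : (0 : ℝ) < pulls h kstar := by exact_mod_cast Nat.pos_of_ne_zero h0
  -- The level `y` lies above `μ l θstar` by the deviation of the empirical mean of `l` plus a
  -- Gaussian tail of probability `exp (-L)`. By `hrare` it is still within one posterior standard
  -- deviation of `kstar` above `μ kstar θstar`.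
  set r := Real.sqrt (σ ^ 2 * L / N) with hr
  set y := μ kstar θstar + (Real.sqrt 5 + Real.sqrt (2 * β)) * r with hy
  have hlow : gaussianReal (empMean h l) (β * σ ^ 2 / (pulls h l : ℝ≥0)) (Set.Ici y) ≠ ∞ :=
    measure_ne_top _ _
  have key := hπ.mul_apply_le hnl hstar y
  have key := ENNReal.toReal_mono (ENNReal.add_ne_top.2 ⟨hlow, measure_ne_top _ _⟩) key
  rw [ENNReal.toReal_mul, ENNReal.toReal_add hlow (measure_ne_top _ _)] at key
  simp only [← measureReal_def] at key
  have hupper : (gaussianReal (empMean h l) (β * σ ^ 2 / (pulls h l : ℝ≥0))).real (Set.Ici y) ≤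
      η := by
    refine (gaussianReal_div_Ici_le _ hV hnl hL ?_).trans hη
    have h1 : Real.sqrt (2 * (5 / 2 * L) * (σ : ℝ) ^ 2 / pulls h l) ≤ Real.sqrt 5 * r := by
      rw [hr, ← Real.sqrt_mul (by norm_num)]
      refine Real.sqrt_le_sqrt ?_
      calc _ = 5 * (σ ^ 2 * L) / pulls h l := by ring
        _ ≤ 5 * (σ ^ 2 * L) / N := by gcongr
        _ = _ := by ring
    have h2 : Real.sqrt (2 * (β * σ ^ 2 : ℝ≥0) * L / pulls h l) ≤ Real.sqrt (2 * β) * r := by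
      rw [hr, ← Real.sqrt_mul (by positivity)]
      refine Real.sqrt_le_sqrt ?_
      push_cast
      calc _ = 2 * β * (σ ^ 2 * L) / pulls h l := by ring
        _ ≤ 2 * β * (σ ^ 2 * L) / N := by gcongr
        _ = _ := by ring
    rw [hy]
    linarith [(abs_lt.1 hl).2, hopt l]
  have hlower : 2 * q ≤
      (gaussianReal (empMean h kstar) (β * σ ^ 2 / (pulls h kstar : ℝ≥0))).real (Set.Ici y) := by
    have hv := coe_variance_pos hV h0
    refine hq.trans (le_gaussianReal_Ici _ (by exact_mod_cast hv.ne') (by positivity) ?_)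
    -- One standard deviation covers `y - μ kstar θstar`; the other `√(2 * (a / β) * L)` cover the
    -- possible underestimation of the mean of `kstar`.
    rw [add_mul, one_mul, ← Real.sqrt_mul (by positivity)]
    have h1 : 2 * (a / β) * L * ((β * σ ^ 2 / (pulls h kstar : ℝ≥0) : ℝ≥0) : ℝ) =
        2 * (a * L) * (σ : ℝ) ^ 2 / pulls h kstar := by
      push_cast
      field_simp
    have h2 : (Real.sqrt 5 + Real.sqrt (2 * β)) * r ≤
        Real.sqrt ((β * σ ^ 2 / (pulls h kstar : ℝ≥0) : ℝ≥0) : ℝ) := by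
      refine Real.le_sqrt_of_sq_le ?_
      rw [mul_pow, hr, Real.sq_sqrt (by positivity)]
      push_cast
      rw [← mul_div_assoc, div_le_div_iff₀ hN' hn]
      calc _ = (σ : ℝ) ^ 2 *
            ((Real.sqrt 5 + Real.sqrt (2 * β)) ^ 2 * L * pulls h kstar) := by ring
        _ ≤ (σ : ℝ) ^ 2 * (β * N) := by gcongr
        _ = _ := by ring
    rw [h1, hy]
    linarith [(abs_lt.1 hs).1]
  have hl0 : 0 ≤ (π i h).real {l} := measureReal_nonneg
  have := mul_le_mul_of_nonneg_right hlower hl0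
  linarith

/-- TS-C rarely pulls the optimal arm less than logarithmically often. -/
lemma summablyRare_starved_tsc (hopt : ∀ k, μ k θstar ≤ μ kstar θstar) (hσ : 0 < σ)
    (hα : 3 < α) (hβ : 1 < β) {M : ℝ} (hM : 0 < M) :
    SummablyRare.{u} μ θstar σ (IsTSC μ α β σ)
      fun _ _ A _ t => {ω | (armCount A kstar t ω : ℝ) < M * Real.log t} := by
  classical
  have hK : 0 < K := kstar.pos
  have hK' : (0 : ℝ) < K := by exact_mod_cast hK
  have hσ' : (0 : ℝ) < σ := hσ
  have hβ' : (1 : ℝ) < β := hβ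
  have hβ0 : (0 : ℝ) < β := by linarith
  set c : ℝ := (4 * K : ℝ)⁻¹ with hc
  have hc0 : 0 < c := by positivity
  -- `a > 1` makes deviations during the first `M log t` pulls summable; `a < β` makes `ρ < 1`, so
  -- that the tail of order about `t ^ (-ρ)` dominates `t ^ (-(1 + ρ) / 2)`.
  set a : ℝ := (1 + β) / 2 with ha
  have ha1 : 1 < a := by linarith
  set ρ : ℝ := a / β with hρ
  have hρ0 : 0 < ρ := by positivity
  have hρ1 : ρ < 1 := (div_lt_one hβ0).2 (by linarith)
  set b : ℝ := Real.sqrt 5 + Real.sqrt (2 * β) with hb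
  refine (((summablyRare_deviation hσ (a := 5 / 2) (by norm_num)).union
    (summablyRare_deviation_initial hσ ha1 hM.le kstar)).union
    (SummablyRare.iUnion fun l : {l // l ≠ kstar} =>
      summablyRare_dominated (M := M) (ρ := (1 + ρ) / 2) l.2 hM.le (by linarith)
        (by linarith))).mono ?_
  filter_upwards [eventually_ge_atTop 2, eventually_le_div hK, eventually_log_le_log hc0,
    eventually_mul_log_lt M hc0, eventually_mul_log_sq_le (b ^ 2 * M) (mul_pos hβ0 hc0),
    eventually_le_gaussian_tail hρ0 hρ1]
    with t ht hN hlog hMt hbt htail Ω _ π ν P A R hrun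
  have := hrun.prob
  have := hrun.markov_policy
  refine ae_of_all _ fun ω (hstarved : (armCount A kstar t ω : ℝ) < M * Real.log t) => ?_
  by_contra hcon
  simp only [Set.mem_union, not_or] at hcon
  obtain ⟨⟨hdev, hinit⟩, hdom⟩ := hcon
  replace hdev : ∀ k, ∀ i ≤ t, armCount A k i ω ≠ 0 →
      |empMean (history A R i ω) k - μ k θstar| <
        Real.sqrt (2 * (5 / 2 * Real.log t) * (σ : ℝ) ^ 2 / armCount A k i ω) := by
    intro k i hi h0
    by_contra hge
    exact hdev ⟨k, i, hi, h0, not_lt.1 hge⟩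
  have ht0 : (0 : ℝ) < t := by positivity
  have hlogt : 0 < Real.log t := Real.log_pos (by exact_mod_cast ht)
  set N := t / (2 * K) with hNdef
  have hN0 : (0 : ℝ) < N := (mul_pos hc0 ht0).trans_le hN
  have hN0' : N ≠ 0 := by exact_mod_cast hN0.ne'
  obtain ⟨l, hl⟩ := exists_armCount_ge hK A t ω
  have hJ : armCount A kstar t ω ≤ ⌊M * Real.log t⌋₊ := Nat.le_floor hstarved.le
  have hne : l ≠ kstar := by
    rintro rfl
    have h1 : (N : ℝ) ≤ armCount A l t ω := by
      have : N ≤ armCount A l t ω := by omega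
      exact_mod_cast this
    linarith
  refine hdom (Set.mem_iUnion.2 ⟨⟨l, hne⟩, ?_, hJ⟩)
  -- Each round in which `l` is pulled with at least `N` earlier pulls is shown to be dominated,
  -- which contradicts the complement of the third rare event.
  have hcount : N ≤ ∑ i ∈ Finset.range t, if A i ω = l ∧ N ≤ armCount A l i ω then 1 else 0 := by
    rw [sum_pulls_ge]
    omega
  refine hcount.trans (Finset.sum_le_sum fun i hi => ?_)
  by_cases hif : A i ω = l ∧ N ≤ armCount A l i ω
  swap
  · rw [if_neg hif]
    exact Nat.zero_le _
  rw [if_pos hif, if_pos]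
  refine ⟨hif.1, ?_⟩
  have hit : i ≤ t := (Finset.mem_range.1 hi).le
  have hni : c * t ≤ i :=
    hN.trans ((Nat.cast_le.2 hif.2).trans (Nat.cast_le.2 (armCount_le i)))
  have hθ := mem_confSet_of_deviation (μ := μ) (σ := σ) hα hdev hit (hlog i hni)
  have hcountle : armCount A kstar i ω ≤ armCount A kstar t ω :=
    armCount_mono (A := A) (k := kstar) (ω := ω) hit
  have hnM : (armCount A kstar i ω : ℝ) ≤ M * Real.log t :=
    (Nat.cast_le.2 hcountle).trans hstarved.le
  have key := hrun.policy.dominated (q := (t : ℝ) ^ (-((1 + ρ) / 2))) (η := (t : ℝ)⁻¹)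
    (L := Real.log t) (a := a) (N := N) (l := l) hopt hσ (by positivity) hθ hN0'
    (by rw [pulls_history]; exact hif.2) hlogt.le (by linarith)
    (by rw [pulls_history]; exact hdev l i hit (by omega))
    (by
      rw [pulls_history]
      intro h0
      by_contra hge
      refine hinit ⟨i, hit, h0, hcountle.trans hJ, ?_⟩
      simpa using not_lt.1 hge)
    (by
      rw [pulls_history]
      calc b ^ 2 * Real.log t * armCount A kstar i ω
          ≤ b ^ 2 * Real.log t * (M * Real.log t) := by gcongr
        _ = b ^ 2 * M * Real.log t ^ 2 := by ring
        _ ≤ β * c * t := hbt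
        _ = β * (c * t) := by ring
        _ ≤ β * N := by gcongr)
    htail
    (by rw [Real.exp_neg, Real.exp_log ht0])
  have hfin : ∀ j, π i (history A R i ω) {j} = ENNReal.ofReal ((π i (history A R i ω)).real {j}) :=
    fun j => (ofReal_measureReal (measure_ne_top _ _)).symm
  rw [dominatedRounds, Set.mem_ofPred_eq, hfin l, hfin kstar]
  have hq : (((t : ℝ≥0) ^ (-((1 + ρ) / 2)) : ℝ≥0) : ℝ≥0∞) =
      ENNReal.ofReal ((t : ℝ) ^ (-((1 + ρ) / 2))) := by
    rw [ENNReal.ofReal, Real.toNNReal_rpow_of_nonneg ht0.le, Real.toNNReal_natCast]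
  have hη : (((t : ℝ≥0)⁻¹ : ℝ≥0) : ℝ≥0∞) = ENNReal.ofReal (t : ℝ)⁻¹ := by
    rw [ENNReal.ofReal, Real.toNNReal_inv, Real.toNNReal_natCast]
  have h2 : (2⁻¹ : ℝ≥0∞) = ENNReal.ofReal 2⁻¹ := by
    rw [ENNReal.ofReal_inv_of_pos (by norm_num)]
    simp
  rw [hq, hη, h2, ← ENNReal.ofReal_mul (by positivity), ← ENNReal.ofReal_mul (by norm_num),
    ← ENNReal.ofReal_add (by positivity) (by positivity)]
  exact ENNReal.ofReal_le_ofReal key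

/-- TS-C rarely pulls a suboptimal arm that has been pulled logarithmically often. -/
lemma exists_summablyRare_pull_tsc (hopt : ∀ k, μ k θstar ≤ μ kstar θstar) (hσ : 0 < σ)
    (hα : 3 < α) (hβ : 1 < β) {k : Fin K} (hk : μ k θstar < μ kstar θstar) :
    ∃ L : ℝ, 0 ≤ L ∧ SummablyRare.{u} μ θstar σ (IsTSC μ α β σ)
      fun _ _ A _ t => {ω | A t ω = k ∧ L * Real.log t ≤ armCount A k t ω} := by
  have hσ' : (0 : ℝ) < σ := hσ
  have hβ0 : 0 < β := by positivity
  have hβ' : (0 : ℝ) < β := hβ0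
  set Δ := μ kstar θstar - μ k θstar with hΔ
  have hΔ0 : 0 < Δ := sub_pos.2 hk
  -- After `L log t` pulls both the confidence width and the Gaussian deviation of tail probability
  -- `t ^ (-2)` are at most `Δ / 4`.
  set L : ℝ := 64 * (α + β) * σ ^ 2 / Δ ^ 2 with hLdef
  have hL0 : 0 < L := by positivity
  -- Randomised choices cannot be excluded pathwise, so the remaining event records that `k` was
  -- pulled although its conditional probability was small.
  have hrare : SummablyRare.{u} μ θstar σ (IsTSC μ α β σ) fun _ π A R t =>
      {ω | A t ω = k ∧ (π t (history A R t ω)).real {k} ≤ 2 * (t : ℝ) ^ (-2 : ℝ)} := by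
    refine SummablyRare.of_eventually_le (f := fun t : ℕ => 2 * (t : ℝ) ^ (-2 : ℝ))
      ((Real.summable_nat_rpow.2 (by norm_num)).mul_left 2)
      (Eventually.of_forall ?_)
    intro t Ω _ π ν P A R hrun
    have := hrun.prob
    have := hrun.markov_policy
    refine hrun.run.measureReal_inter_le t k
      (B := {ω | (π t (history A R t ω)).real {k} ≤ 2 * (t : ℝ) ^ (-2 : ℝ)}) ?_ (by positivity)
      fun ω hω => hω
    exact comap_measurable (history A R t) (measurableSet_le
      ((π t).measurable_coe (measurableSet_singleton k)).ennreal_toReal measurable_const)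
  refine ⟨L, hL0.le, (((summablyRare_notMem_confSet hσ (α := α) (by linarith)).union
    (summablyRare_starved_tsc hopt hσ hα hβ hL0)).union hrare).mono ?_⟩
  filter_upwards [eventually_ge_atTop 2] with t ht Ω _ π ν P A R hrun
  have := hrun.prob
  have := hrun.markov_policy
  refine ae_of_all _ fun ω hpull => ?_
  obtain ⟨hA, hn⟩ : A t ω = k ∧ L * Real.log t ≤ armCount A k t ω := hpull
  by_cases hθ : θstar ∈ confSet μ α σ (history A R t ω)
  swap
  · exact Or.inl (Or.inl hθ)
  by_cases hs : (armCount A kstar t ω : ℝ) < L * Real.log t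
  · exact Or.inl (Or.inr hs)
  refine Or.inr ⟨hA, ?_⟩
  have ht0 : (0 : ℝ) < t := by positivity
  have hlog : 0 < Real.log t := Real.log_pos (by exact_mod_cast ht)
  have hsmall : ∀ j, L * Real.log t ≤ armCount A j t ω → pulls (history A R t ω) j ≠ 0 ∧
      width α σ (history A R t ω) j ≤ Δ / 4 ∧
      Real.sqrt (2 * (β * σ ^ 2 : ℝ≥0) * (2 * Real.log t) / pulls (history A R t ω) j) ≤
        Δ / 4 := by
    intro j hj
    have hj0 : (0 : ℝ) < armCount A j t ω := (mul_pos hL0 hlog).trans_le hj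
    rw [width, pulls_history]
    have h1 : 4 * (α + β) * σ ^ 2 * Real.log t ≤ (Δ / 4) ^ 2 * armCount A j t ω := by
      calc _ = (Δ / 4) ^ 2 * (L * Real.log t) := by
            rw [hLdef]
            field_simp
            ring
        _ ≤ _ := mul_le_mul_of_nonneg_left hj (by positivity)
    have h2 : 0 ≤ β * ((σ : ℝ) ^ 2 * Real.log t) := by positivity
    have h3 : 0 ≤ α * ((σ : ℝ) ^ 2 * Real.log t) := by positivity
    refine ⟨by exact_mod_cast hj0.ne', Real.sqrt_le_iff.2 ⟨by positivity, ?_⟩,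
      Real.sqrt_le_iff.2 ⟨by positivity, ?_⟩⟩
    · rw [div_le_iff₀ hj0]
      linarith
    · rw [div_le_iff₀ hj0]
      push_cast
      linarith
  obtain ⟨hk0, hkw, hkd⟩ := hsmall k hn
  obtain ⟨hs0, hsw, hsd⟩ := hsmall kstar (not_lt.1 hs)
  have h1 := abs_lt.1 (hθ k hk0)
  have h2 := abs_lt.1 (hθ kstar hs0)
  -- The midpoint of the two means: a pull of `k` needs one of the two samples to stray by `Δ / 2`
  -- from its true mean.
  set y := μ kstar θstar - Δ / 2 with hy
  have hV : 0 < β * σ ^ 2 := by positivity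
  have hup := gaussianReal_div_Ici_le (y := y) (empMean (history A R t ω) k) hV hk0
    (L := 2 * Real.log t) (by positivity) (by linarith [h1.1])
  have hlo := gaussianReal_div_Iic_le (y := y) (empMean (history A R t ω) kstar) hV hs0
    (L := 2 * Real.log t) (by positivity) (by linarith [h2.2])
  have hexp : Real.exp (-(2 * Real.log t)) = (t : ℝ) ^ (-2 : ℝ) := by
    rw [Real.rpow_def_of_pos ht0]
    congr 1
    ring
  rw [hexp] at hup hlo
  have key := ENNReal.toReal_mono
    (ENNReal.add_ne_top.2 ⟨measure_ne_top _ _, measure_ne_top _ _⟩)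
    (hrun.policy.apply_le_add hk0 (optimal_mem_candidates hopt hθ) y)
  rw [ENNReal.toReal_add (measure_ne_top _ _) (measure_ne_top _ _)] at key
  simp only [← measureReal_def] at key
  linarith

end TS

end StructuredBandit

theorem theorem1 {K : ℕ} {Θ : Type*} (μ : Fin K → Θ → ℝ) (θstar : Θ) (kstar : Fin K)
    (hopt : ∀ k, μ k θstar ≤ μ kstar θstar)
    (σ : ℝ≥0) (hσ : 0 < σ) (α : ℝ) (hα : 3 < α) (β : ℝ≥0) (hβ : 1 < β) :
    -- UCB-C
    (∃ c₁ c₂ : ℝ, 0 ≤ c₁ ∧ 0 ≤ c₂ ∧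
      ∀ (ν : Kernel (Fin K) ℝ) [IsMarkovKernel ν], StructuredBandit.IsRewardLaw μ θstar σ ν →
      ∀ (π : StructuredBandit.Policy K) [∀ t, IsMarkovKernel (π t)],
        StructuredBandit.IsUCBC μ α σ π →
      ∀ {Ω : Type*} [MeasurableSpace Ω] (P : Measure Ω) [IsProbabilityMeasure P]
        (A : ℕ → Ω → Fin K) (R : ℕ → Ω → ℝ), StructuredBandit.IsRun π ν P A R →
        (∀ T : ℕ, 2 ≤ T → StructuredBandit.expRegret μ kstar θstar P A T ≤
          ((StructuredBandit.numCompetitive μ kstar θstar : ℝ) - 1) * (c₁ * Real.log T) +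
          ((K : ℝ) - (StructuredBandit.numCompetitive μ kstar θstar : ℝ)) * c₂) ∧
        (StructuredBandit.numCompetitive μ kstar θstar = 1 →
          ∀ T : ℕ, StructuredBandit.expRegret μ kstar θstar P A T ≤ ((K : ℝ) - 1) * c₂)) ∧
    -- TS-C
    (∃ c₁ c₂ : ℝ, 0 ≤ c₁ ∧ 0 ≤ c₂ ∧
      ∀ (ν : Kernel (Fin K) ℝ) [IsMarkovKernel ν], StructuredBandit.IsRewardLaw μ θstar σ ν →
      ∀ (π : StructuredBandit.Policy K) [∀ t, IsMarkovKernel (π t)],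
        StructuredBandit.IsTSC μ α β σ π →
      ∀ {Ω : Type*} [MeasurableSpace Ω] (P : Measure Ω) [IsProbabilityMeasure P]
        (A : ℕ → Ω → Fin K) (R : ℕ → Ω → ℝ), StructuredBandit.IsRun π ν P A R →
        (∀ T : ℕ, 2 ≤ T → StructuredBandit.expRegret μ kstar θstar P A T ≤
          ((StructuredBandit.numCompetitive μ kstar θstar : ℝ) - 1) * (c₁ * Real.log T) +
          ((K : ℝ) - (StructuredBandit.numCompetitive μ kstar θstar : ℝ)) * c₂) ∧
        (StructuredBandit.numCompetitive μ kstar θstar = 1 →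
          ∀ T : ℕ, StructuredBandit.expRegret μ kstar θstar P A T ≤ ((K : ℝ) - 1) * c₂)) := by
  exact
    ⟨StructuredBandit.exists_expRegret_le hopt hσ (by linarith)
      (fun _ hπ t h k hk => (hπ t h k hk).1)
      (fun M _ => StructuredBandit.summablyRare_starved_ucb hopt hσ hα M)
      (fun _ hk => StructuredBandit.exists_summablyRare_pull_ucb hopt hσ hα hk),
    StructuredBandit.exists_expRegret_le hopt hσ (by linarith)
      (fun _ hπ _ _ _ hk => hπ.mem_candidates hk)
      (fun _ hM => StructuredBandit.summablyRare_starved_tsc hopt hσ hα hβ hM)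
      (fun _ hk => StructuredBandit.exists_summablyRare_pull_tsc hopt hσ hα hβ hk)⟩
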